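/- Let $V_0>0$ and let $V(x)=0$ for $x<0$, $V(x)=V_0$ for $x>0$ (units $\hbar=m=1$). For an energy $\varepsilon>0$ put $k=\sqrt{2\varepsilon}$, $\alpha=\sqrt{2V_0-k^2}$ (if $\varepsilon<V_0$) and $\beta=\sqrt{k^2-2V_0}$ (if $\varepsilon>V_0$), and consider the three families of functions, each continuous at $x=0$, - $\psi^0_k(x)=\sqrt{\tfrac{2k^2}{\pi(\alpha^2+k^2)}}\cos(kx)-\sqrt{\tfrac{2\alpha^2}{\pi(\alpha^2+k^2)}}\sin(kx)$ for $x\le0$ and $\sqrt{\tfrac{2k^2}{\pi(\alpha^2+k^2)}}\,e^{-\alpha x}$ for $x>0$, where $0<k<\sqrt{2V_0}$; - $\psi^1_k(x)=\tfrac1{\sqrt\pi}\cos(kx)$ for $x\le0$ and $\tfrac1{\sqrt\pi}\cos(\beta x)$ for $x>0$, where $k>\sqrt{2V_0}$; - $\psi^2_k(x)=\sqrt{\tfrac{2\beta^2}{\pi(\beta^2+k^2)}}\sin(kx)$ for $x\le0$ and $\sqrt{\tfrac{2k^2}{\pi(\beta^2+k^2)}}\sin(\beta x)$ for $x>0$,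 where $k>\sqrt{2V_0}$; with the spectral functions $$\kappa_0=k,\qquad \kappa_1=\frac{(\beta+k)^2+(\beta^2+k^2)}{3(\beta+k)}+\frac{\sqrt{2V_0}}3,\qquad \kappa_2=-\frac{(\beta+k)^2+2\beta k}{3(\beta+k)}+\frac{\sqrt{2V_0}}3 .$$ Let $I_0=(0,\sqrt{2V_0})$, $I_1=I_2=(\sqrt{2V_0},\infty)$, and for a function $f$ let $\varphi^i_f(k)=\int_{\mathbb R}\overline{\psi^i_k(x)}\,f(x)\,dx$. (a) On $I_i$ the function $\kappa_i$ is differentiable in $k$, and each $\psi^i_k$ with $k\in I_i$ is a nonzero bounded $C^1$ function satisfying $-\tfrac12\psi''+V\psi=\tfrac{k^2}{2}\psi$ for $x\ne0$. (b) The three families together form a complete set: for every $f\in L^2(\mathbb R;\mathbb C)$ there are $a_i\in L^2(I_i,|\tfrac{d\kappa_i}{dk}|dk)$, $i=0,1,2$, such that $\varphi^i_{f\mathbf 1_{[-R,R]}}\to a_i$ in $L^2(I_i,|\tfrac{d\kappa_i}{dk}|dk)$ as $R\to\infty$, and $$\sum_{i=0}^2\int_{I_i\cap(-\infty,K]}a_i(k)\,\psi^i_k(x)\,\Big|\frac{d\kappa_i}{dk}\Big|\,dk\;\longrightarrow\;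 f\quad\text{in }L^2(\mathbb R)\text{ as }K\to\infty,$$ where for every $K$ and $x$ the integrals on the left converge absolutely. (c) Every box state is recovered pointwise. Let $j\ge1$ be an integer, $\tau\in\mathbb R$, $\sigma>0$ (so that the box may lie on one side of $0$ or straddle it), and let $\Psi_j(x)=\sqrt{2/\sigma}\,\sin\!\big(\tfrac{j\pi}{\sigma}(x-\tau)\big)$ for $\tau<x<\tau+\sigma$ and $\Psi_j(x)=0$ otherwise. Then for every $x\in\mathbb R$, including $x=0,\tau,\tau+\sigma$, $$\sum_{i=0}^2\int_{I_i}\varphi^i_{\Psi_j}(k)\,\psi^i_k(x)\,\Big|\frac{d\kappa_i}{dk}\Big|\,dk=\Psi_j(x),$$ with absolutely convergent integrals. -/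

import Mathlib

open MeasureTheory Filter Topology

noncomputable section

/-- The box initial state: the `j`-th eigenstate of the infinite well on `(τ, τ + σ)`,
extended by zero. -/
def boxState (j : ℕ) (τ σ : ℝ) (x : ℝ) : ℂ :=
  if τ < x ∧ x < τ + σ then
    ((Real.sqrt (2 / σ) * Real.sin (j * Real.pi / σ * (x - τ)) : ℝ) : ℂ)
  else 0

/-- The step potential: `0` for `x < 0` and `V₀` for `x > 0` (its value at `0` is never used). -/
def stepPotential (V₀ : ℝ) (x : ℝ) : ℝ := if x < 0 then 0 else V₀

/-- `φ` is a (generalized, i.e. bounded) stationary state of energy `ε` for the potential `V`, which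
may jump at `0`: a nonzero bounded `C¹` function with `-φ''/2 + V φ = ε φ` off `0`
(in units where `ħ = m = 1`). -/
def IsEigenstate (V : ℝ → ℝ) (ε : ℝ) (φ : ℝ → ℂ) : Prop :=
  φ ≠ 0 ∧ (∃ C : ℝ, ∀ x, ‖φ x‖ ≤ C) ∧ ContDiff ℝ 1 φ ∧
    ∀ x, x ≠ 0 → DifferentiableAt ℝ (deriv φ) x ∧
      -(1 / 2 : ℂ) * deriv (deriv φ) x + (V x : ℂ) * φ x = (ε : ℂ) * φ x

/-- Decay rate on the right for `k² / 2 = ε < V₀`. -/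
def stepAlpha (V₀ k : ℝ) : ℝ := Real.sqrt (2 * V₀ - k ^ 2)

/-- Wave number on the right for `k² / 2 = ε > V₀`. -/
def stepBeta (V₀ k : ℝ) : ℝ := Real.sqrt (k ^ 2 - 2 * V₀)

/-- The evanescent states, for `0 < k < √(2 V₀)`. -/
def evanescentState (V₀ k x : ℝ) : ℝ :=
  if x ≤ 0 then
    Real.sqrt (2 * k ^ 2 / (Real.pi * (stepAlpha V₀ k ^ 2 + k ^ 2))) * Real.cos (k * x)
      - Real.sqrt (2 * stepAlpha V₀ k ^ 2 / (Real.pi * (stepAlpha V₀ k ^ 2 + k ^ 2)))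
        * Real.sin (k * x)
  else
    Real.sqrt (2 * k ^ 2 / (Real.pi * (stepAlpha V₀ k ^ 2 + k ^ 2)))
      * Real.exp (-(stepAlpha V₀ k * x))

/-- The cosine-type states, for `k > √(2 V₀)`. -/
def cosineState (V₀ k x : ℝ) : ℝ :=
  if x ≤ 0 then 1 / Real.sqrt Real.pi * Real.cos (k * x)
  else 1 / Real.sqrt Real.pi * Real.cos (stepBeta V₀ k * x)

/-- The sine-type states, for `k > √(2 V₀)`. -/
def sineState (V₀ k x : ℝ) : ℝ :=
  if x ≤ 0 then
    Real.sqrt (2 * stepBeta V₀ k ^ 2 / (Real.pi * (stepBeta V₀ k ^ 2 + k ^ 2))) * Real.sin (k * x)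
  else
    Real.sqrt (2 * k ^ 2 / (Real.pi * (stepBeta V₀ k ^ 2 + k ^ 2))) * Real.sin (stepBeta V₀ k * x)

/-- The three families of eigenstates, labelled by `k = √(2 ε)`. -/
def stepState (V₀ : ℝ) : Fin 3 → ℝ → ℝ → ℂ
  | 0 => fun k x => (evanescentState V₀ k x : ℂ)
  | 1 => fun k x => (cosineState V₀ k x : ℂ)
  | 2 => fun k x => (sineState V₀ k x : ℂ)

/-- The range of `k` for each family: `0 < ε < V₀` for the first one, `ε > V₀` for the others. -/
def stepRange (V₀ : ℝ) : Fin 3 → Set ℝ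
  | 0 => Set.Ioo 0 (Real.sqrt (2 * V₀))
  | 1 => Set.Ioi (Real.sqrt (2 * V₀))
  | 2 => Set.Ioi (Real.sqrt (2 * V₀))

/-- The spectral functions `κ₀, κ₁, κ₂`, as functions of `k = √(2 ε)`. -/
def stepSpectral (V₀ : ℝ) : Fin 3 → ℝ → ℝ
  | 0 => fun k => k
  | 1 => fun k =>
      ((stepBeta V₀ k + k) ^ 2 + (stepBeta V₀ k ^ 2 + k ^ 2)) / (3 * (stepBeta V₀ k + k))
        + Real.sqrt (2 * V₀) / 3
  | 2 => fun k =>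
      -(((stepBeta V₀ k + k) ^ 2 + 2 * stepBeta V₀ k * k) / (3 * (stepBeta V₀ k + k)))
        + Real.sqrt (2 * V₀) / 3

/-- The measure `|dκᵢ/dk| dk` on the range of the `i`-th family. -/
def stepMeasure (V₀ : ℝ) (i : Fin 3) : Measure ℝ :=
  (volume.restrict (stepRange V₀ i)).withDensity
    (fun k => ENNReal.ofReal |deriv (stepSpectral V₀ i) k|)

/-- The probability amplitude `∫ ψ_k(x)* f(x) dx`. -/
def amplitude (ψ : ℝ → ℝ → ℂ) (f : ℝ → ℂ) (k : ℝ) : ℂ :=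
  ∫ x, (starRingEnd ℂ) (ψ k x) * f x

/-- Completeness of finitely many families `ψ i k`, with spectral measures `ν i`, in `L²(ℝ)`: every
square-integrable `f` has amplitudes `a i ∈ L²(ν i)`, the mean-square limits of the
amplitudes of the truncations of `f` to `[-R, R]`, and `f` is the mean-square limit, as `K → ∞`, of
the superpositions of the states with `k ≤ K` with these amplitudes. -/
def IsCompleteSystem {ι : Type*} [Fintype ι] (ψ : ι → ℝ → ℝ → ℂ) (ν : ι → Measure ℝ) : Prop :=
  ∀ f : ℝ → ℂ, MemLp f 2 volume →
    ∃ a : ι → ℝ → ℂ,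
      (∀ i, MemLp (a i) 2 (ν i)) ∧
      (∀ i, Tendsto (fun R : ℝ => eLpNorm
        (fun k => amplitude (ψ i) ((Set.Icc (-R) R).indicator f) k - a i k) 2 (ν i))
        atTop (𝓝 0)) ∧
      (∀ i x K, IntegrableOn (fun k => a i k * ψ i k x) (Set.Iic K) (ν i)) ∧
      Tendsto (fun K : ℝ => eLpNorm
        (fun x => (∑ i, ∫ k in Set.Iic K, a i k * ψ i k x ∂(ν i)) - f x) 2 volume)
        atTop (𝓝 0)

end

section StepCompleteness

open scoped InnerProductSpace ComplexConjugate Interval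

/-! ### Functions determined by their integrals over intervals -/

/-! Completeness is Parseval's identity for the indicators of the intervals between `0` and `b`,
which span a dense subspace of L². Once the amplitudes of these indicators have the same Gram matrix
as the indicators themselves (`sum_integral_amplitude_mul_conj`), they define an isometry `U` from
L² into the direct sum of the spaces L²(νᵢ) (`exists_isometry_of_gram_eq`), so that U*U = 1.
Fubini's theorem identifies `U` with the amplitude integral on L¹ ∩ L² and U* with the superposition
integral on integrable coefficients; truncating in `x` and in `k` and using continuity of `U` and U*
gives (b) (`isCompleteSystem_of_resolution`).

The Gram identity is Stone's formula done by hand. Let J(k) be `k` times the kernel of the resolvent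
of -d²/dx² + 2V at the point k², integrated over two intervals. On the real axis the weighted sum of
products of amplitudes equals (2/π) Im J(k); this is where the normalizations and the functions κᵢ
enter (`isIntervalDensity_left`, `isIntervalDensity_right`, `isIntervalDensity_cross`). J is
holomorphic in the open first quadrant, continuous up to its edge, purely imaginary on the imaginary
axis, and equals -m/k + O(|k|⁻²) at infinity, where m is the length of the overlap of the two
intervals. Cauchy's theorem then gives that the integral of Im J over (0, ∞) is mπ/2
(`integral_im_eq_of_quadrant`). There is no bound-state contribution because k + √(k² - 2V₀) never
vanishes.

For (c), Green's identity and the vanishing of the box sine at both walls make the amplitudes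
O(k⁻²). The superposition then converges absolutely to a continuous function of `x`; it equals the
box state almost everywhere by U*U = 1, hence everywhere. Part (a) is direct differentiation
together with the matching of value and slope at 0. -/

theorem ae_eq_of_forall_setIntegral_uIoc_eq {f g : ℝ → ℂ} (hf : LocallyIntegrable f)
    (hg : LocallyIntegrable g) (h : ∀ b : ℝ, ∫ x in Ι 0 b, f x = ∫ x in Ι 0 b, g x) :
    f =ᵐ[volume] g := by
  have heq : (fun x => ∫ t in (0:ℝ)..x, f t) = fun x => ∫ t in (0:ℝ)..x, g t := by
    funext x
    rw [intervalIntegral.intervalIntegral_eq_integral_uIoc,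
      intervalIntegral.intervalIntegral_eq_integral_uIoc, h]
  -- Lebesgue differentiation: each function is almost everywhere the derivative of its primitive,
  -- and the two primitives coincide.
  filter_upwards [_root_.LocallyIntegrable.ae_hasDerivAt_integral hf,
    _root_.LocallyIntegrable.ae_hasDerivAt_integral hg] with x hfx hgx
  have h1 := hfx 0
  rw [heq] at h1
  exact h1.unique (hgx 0)

theorem volume_uIoc_ne_top (a b : ℝ) : volume (Ι a b) ≠ ⊤ := by
  rw [Set.uIoc]; exact measure_Ioc_lt_top.ne

/-- The indicator function of the interval between `0` and `b`, as an element of `L²`. -/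
noncomputable def intervalLp (b : ℝ) : Lp ℂ 2 (volume : Measure ℝ) :=
  indicatorConstLp 2 measurableSet_uIoc (volume_uIoc_ne_top 0 b) 1

theorem inner_intervalLp (b : ℝ) (f : Lp ℂ 2 (volume : Measure ℝ)) :
    ⟪intervalLp b, f⟫_ℂ = ∫ x in Ι 0 b, f x :=
  L2.inner_indicatorConstLp_one _ _ _

theorem Lp.locallyIntegrable_two (f : Lp ℂ 2 (volume : Measure ℝ)) : LocallyIntegrable f :=
  (Lp.memLp f).locallyIntegrable (by norm_num)

theorem eq_zero_of_forall_inner_intervalLp {f : Lp ℂ 2 (volume : Measure ℝ)}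
    (h : ∀ b, ⟪intervalLp b, f⟫_ℂ = 0) : f = 0 := by
  rw [Lp.eq_zero_iff_ae_eq_zero]
  refine ae_eq_of_forall_setIntegral_uIoc_eq (Lp.locallyIntegrable_two f)
    (locallyIntegrable_const 0) fun b => ?_
  rw [← inner_intervalLp, h]; simp

/-- A vector orthogonal to all these indicators has zero integral between `0` and every `b`, hence
vanishes, so the span has trivial orthogonal complement. -/
theorem denseRange_linearCombination_intervalLp :
    DenseRange (Finsupp.linearCombination ℂ intervalLp) := by
  have h : (Submodule.span ℂ (Set.range intervalLp)).topologicalClosure = ⊤ := by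
    rw [Submodule.topologicalClosure_eq_top_iff, Submodule.eq_bot_iff]
    intro f hf
    refine eq_zero_of_forall_inner_intervalLp fun b => ?_
    exact (Submodule.mem_orthogonal _ _).1 hf _ (Submodule.subset_span ⟨b, rfl⟩)
  rw [DenseRange, ← LinearMap.coe_range, Finsupp.range_linearCombination]
  exact Submodule.dense_iff_topologicalClosure_eq_top.2 h

/-! ### Isometries determined by a Gram matrix -/

theorem inner_linearCombination_self {H : Type*} [NormedAddCommGroup H] [InnerProductSpace ℂ H]
    {α : Type*} (e : α → H) (c : α →₀ ℂ) :
    ⟪Finsupp.linearCombination ℂ e c, Finsupp.linearCombination ℂ e c⟫_ℂ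
      = ∑ a ∈ c.support, ∑ b ∈ c.support, conj (c a) * (c b * ⟪e a, e b⟫_ℂ) := by
  simp only [Finsupp.linearCombination_apply, Finsupp.sum, sum_inner, inner_sum, inner_smul_left,
    inner_smul_right, Finset.mul_sum]
  rw [Finset.sum_comm]
  refine Finset.sum_congr rfl fun a _ => Finset.sum_congr rfl fun b _ => ?_
  ring

/-- The norm of a finite combination depends only on its coefficients and the Gram matrix. Hence
sending each `e a` to `E a` is well defined and isometric on the span, without linear independence,
and extends by density. -/
theorem exists_isometry_of_gram_eq {H K : Type*} [NormedAddCommGroup H] [InnerProductSpace ℂ H]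
    [NormedAddCommGroup K] [InnerProductSpace ℂ K] [CompleteSpace K]
    {α : Type*} (e : α → H) (E : α → K) (he : DenseRange (Finsupp.linearCombination ℂ e))
    (h : ∀ a b, ⟪E a, E b⟫_ℂ = ⟪e a, e b⟫_ℂ) :
    ∃ U : H →L[ℂ] K, (∀ a, U (e a) = E a) ∧ ∀ x, ‖U x‖ = ‖x‖ := by
  have hn : ∀ c, ‖Finsupp.linearCombination ℂ E c‖ = ‖Finsupp.linearCombination ℂ e c‖ := by
    intro c
    have h1 := inner_linearCombination_self E c
    simp only [h] at h1
    rw [← inner_linearCombination_self e c, inner_self_eq_norm_sq_to_K,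
      inner_self_eq_norm_sq_to_K] at h1
    norm_cast at h1
    exact (sq_eq_sq₀ (norm_nonneg _) (norm_nonneg _)).1 h1
  have hb : ∃ C, ∀ c, ‖Finsupp.linearCombination ℂ E c‖
      ≤ C * ‖Finsupp.linearCombination ℂ e c‖ := ⟨1, fun c => by rw [hn, one_mul]⟩
  refine ⟨(Finsupp.linearCombination ℂ E).extendOfNorm (Finsupp.linearCombination ℂ e), ?_, ?_⟩
  · intro a
    have := LinearMap.extendOfNorm_eq he hb (Finsupp.single a 1)
    simpa using this
  · refine he.induction ?_ (isClosed_eq (by fun_prop) (by fun_prop))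
    rintro _ ⟨c, rfl⟩
    rw [LinearMap.extendOfNorm_eq he hb, hn]

/-! ### Superpositions -/

section Superposition

variable {ψ : ℝ → ℝ → ℂ} {ν : Measure ℝ} {C : ℝ}

theorem amplitude_indicator_one (ψ : ℝ → ℝ → ℂ) (b k : ℝ) :
    amplitude ψ ((Ι 0 b).indicator 1) k = conj (∫ x in Ι 0 b, ψ k x) := by
  rw [amplitude, ← integral_conj, ← integral_indicator measurableSet_uIoc]
  congr 1 with x
  by_cases hx : x ∈ Ι 0 b <;> simp [hx]

theorem integrable_prod_of_bounded [SFinite ν] (hψ : Measurable (Function.uncurry ψ))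
    (hC : ∀ k x, ‖ψ k x‖ ≤ C) {b g : ℝ → ℂ} (hb : Integrable b ν) (hg : Integrable g) :
    Integrable (Function.uncurry fun k x => b k * (ψ k x * g x)) (ν.prod volume) := by
  have h := (hb.mul_prod hg).bdd_mul (f := Function.uncurry ψ) (c := C)
    hψ.aestronglyMeasurable (Eventually.of_forall fun z => hC z.1 z.2)
  refine h.congr (Eventually.of_forall fun z => ?_)
  simp only [Function.uncurry]; ring

/-- Fubini, permitted because `ψ` is bounded and both `b` and `g` are integrable. This is the formal
adjointness of superposition and amplitude behind the two identifications that follow. -/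
theorem integral_superposition_mul [SFinite ν] (hψ : Measurable (Function.uncurry ψ))
    (hC : ∀ k x, ‖ψ k x‖ ≤ C) {b g : ℝ → ℂ} (hb : Integrable b ν) (hg : Integrable g) :
    ∫ x, (∫ k, b k * ψ k x ∂ν) * g x = ∫ k, b k * (∫ x, ψ k x * g x) ∂ν := by
  have h := integral_integral_swap (integrable_prod_of_bounded hψ hC hb hg)
  simp only [integral_const_mul] at h
  rw [h]
  congr 1 with x
  rw [← integral_mul_const]
  congr 1 with k
  ring

theorem norm_superposition_le (hC : ∀ k x, ‖ψ k x‖ ≤ C) {b : ℝ → ℂ} (hb : Integrable b ν)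
    (x : ℝ) : ‖∫ k, b k * ψ k x ∂ν‖ ≤ (∫ k, ‖b k‖ ∂ν) * C := by
  rw [← integral_mul_const]
  refine norm_integral_le_of_norm_le (hb.norm.mul_const C) (Eventually.of_forall fun k => ?_)
  rw [norm_mul]
  exact mul_le_mul_of_nonneg_left (hC k x) (norm_nonneg _)

theorem aestronglyMeasurable_superposition [SFinite ν] (hψ : Measurable (Function.uncurry ψ))
    {b : ℝ → ℂ} (hb : Integrable b ν) :
    AEStronglyMeasurable (fun x => ∫ k, b k * ψ k x ∂ν) volume := by
  have h : AEStronglyMeasurable (fun z : ℝ × ℝ => b z.2 * ψ z.2 z.1)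
      ((volume : Measure ℝ).prod ν) :=
    (hb.1.comp_snd).mul (hψ.comp measurable_swap).aestronglyMeasurable
  exact h.integral_prod_right'

theorem locallyIntegrable_superposition [SFinite ν] (hψ : Measurable (Function.uncurry ψ))
    (hC : ∀ k x, ‖ψ k x‖ ≤ C) {b : ℝ → ℂ} (hb : Integrable b ν) :
    LocallyIntegrable (fun x => ∫ k, b k * ψ k x ∂ν) := by
  have h : LocallyIntegrable (fun _ : ℝ => (∫ k, ‖b k‖ ∂ν) * C) volume := locallyIntegrable_const _
  refine h.mono (aestronglyMeasurable_superposition hψ hb) (Eventually.of_forall fun x => ?_)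
  exact (norm_superposition_le hC hb x).trans (le_abs_self _)

theorem integrable_superposition (hψ : Measurable (Function.uncurry ψ))
    (hC : ∀ k x, ‖ψ k x‖ ≤ C) {b : ℝ → ℂ} (hb : Integrable b ν) (x : ℝ) :
    Integrable (fun k => b k * ψ k x) ν :=
  hb.mul_bdd (c := C) (hψ.comp (measurable_id.prodMk measurable_const)).aestronglyMeasurable
    (Eventually.of_forall fun k => hC k x)

variable {U : Lp ℂ 2 (volume : Measure ℝ) →L[ℂ] Lp ℂ 2 ν}

/-- `U` is given concretely only on intervals, but that is enough to compute the integral of U*b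
over each interval, and these integrals determine U*b. -/
theorem superposition_ae_eq_adjoint [SFinite ν] (hψ : Measurable (Function.uncurry ψ))
    (hC : ∀ k x, ‖ψ k x‖ ≤ C)
    (hU : ∀ b, U (intervalLp b) =ᵐ[ν] amplitude ψ ((Ι 0 b).indicator 1))
    {b : ℝ → ℂ} (hb : Integrable b ν) (hb2 : MemLp b 2 ν) :
    (fun x => ∫ k, b k * ψ k x ∂ν) =ᵐ[volume] U.adjoint hb2.toLp := by
  refine ae_eq_of_forall_setIntegral_uIoc_eq (locallyIntegrable_superposition hψ hC hb)
    (Lp.locallyIntegrable_two _) fun c => ?_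
  rw [← inner_intervalLp, ContinuousLinearMap.adjoint_inner_right, L2.inner_def]
  have hg : Integrable ((Ι 0 c).indicator (1 : ℝ → ℂ)) volume :=
    (integrable_indicator_iff measurableSet_uIoc).2
      (integrableOn_const (volume_uIoc_ne_top 0 c))
  have h := integral_superposition_mul hψ hC hb hg
  calc ∫ x in Ι 0 c, ∫ k, b k * ψ k x ∂ν
      = ∫ x, (∫ k, b k * ψ k x ∂ν) * (Ι 0 c).indicator 1 x := by
        rw [← integral_indicator measurableSet_uIoc]
        congr 1 with x
        by_cases hx : x ∈ Ι 0 c <;> simp [hx]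
    _ = _ := h
    _ = _ := by
        refine integral_congr_ae ?_
        filter_upwards [hU c, hb2.coeFn_toLp] with k h1 h2
        rw [h1, h2, amplitude_indicator_one, RCLike.inner_apply, Complex.conj_conj,
          ← integral_indicator measurableSet_uIoc]
        congr 2 with x
        by_cases hx : x ∈ Ι 0 c <;> simp [hx]

theorem norm_amplitude_le (hC : ∀ k x, ‖ψ k x‖ ≤ C) {g : ℝ → ℂ} (hg : Integrable g) (k : ℝ) :
    ‖amplitude ψ g k‖ ≤ C * ∫ x, ‖g x‖ := by
  rw [amplitude, ← integral_const_mul]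
  refine norm_integral_le_of_norm_le (hg.norm.const_mul C) (Eventually.of_forall fun x => ?_)
  rw [norm_mul, RCLike.norm_conj]
  exact mul_le_mul_of_nonneg_right (hC k x) (norm_nonneg _)

theorem aestronglyMeasurable_amplitude [SFinite ν] (hψ : Measurable (Function.uncurry ψ))
    {g : ℝ → ℂ} (hg : Integrable g) : AEStronglyMeasurable (amplitude ψ g) ν := by
  have h : AEStronglyMeasurable (fun z : ℝ × ℝ => conj (ψ z.1 z.2) * g z.2)
      (ν.prod (volume : Measure ℝ)) :=
    (Complex.continuous_conj.measurable.comp hψ).aestronglyMeasurable.mul hg.1.comp_snd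
  exact h.integral_prod_right'

/-- Tested against the indicator of a set `s` of finite measure, `U` moves to the other side as U*,
which acts on that indicator as the superposition integral already identified. The abstract `U` is
thereby an integral transform on all of L¹ ∩ L². -/
theorem amplitude_ae_eq [SigmaFinite ν] (hψ : Measurable (Function.uncurry ψ))
    (hC : ∀ k x, ‖ψ k x‖ ≤ C)
    (hU : ∀ b, U (intervalLp b) =ᵐ[ν] amplitude ψ ((Ι 0 b).indicator 1))
    {g : ℝ → ℂ} (hg : Integrable g) (hg2 : MemLp g 2 volume) :
    amplitude ψ g =ᵐ[ν] U hg2.toLp := by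
  refine ae_eq_of_forall_setIntegral_eq_of_sigmaFinite ?_ ?_ ?_
  · intro s _ hs'
    have : IsFiniteMeasure (ν.restrict s) := ⟨by simpa using hs'⟩
    exact Integrable.of_bound (aestronglyMeasurable_amplitude hψ hg).restrict _
      (Eventually.of_forall fun k => norm_amplitude_le hC hg k)
  · intro s hs hs'
    have : IsFiniteMeasure (ν.restrict s) := ⟨by simpa using hs'⟩
    exact ((Lp.memLp _).restrict s).integrable (by norm_num)
  · intro s hs hs'
    have hb : Integrable (s.indicator (1 : ℝ → ℂ)) ν :=
      (integrable_indicator_iff hs).2 (integrableOn_const hs'.ne)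
    have hb2 : MemLp (s.indicator (1 : ℝ → ℂ)) 2 ν := memLp_indicator_const 2 hs 1 (Or.inr hs'.ne)
    have h1 : indicatorConstLp 2 hs hs'.ne (1 : ℂ) = hb2.toLp := rfl
    rw [← L2.inner_indicatorConstLp_one hs hs'.ne, h1, ← ContinuousLinearMap.adjoint_inner_left,
      L2.inner_def]
    have hgc : Integrable (fun x => conj (g x)) := by
      simpa using (Complex.conjLIE.toContinuousLinearEquiv.toContinuousLinearMap).integrable_comp hg
    have h := congrArg conj (integral_superposition_mul hψ hC hb hgc)
    rw [← integral_conj, ← integral_conj] at h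
    refine Eq.trans ?_ (h.symm.trans ?_)
    · rw [← integral_indicator hs]
      congr 1 with k
      by_cases hk : k ∈ s
      · simp [hk, amplitude, ← integral_conj]
      · simp [hk]
    · refine integral_congr_ae ?_
      filter_upwards [superposition_ae_eq_adjoint hψ hC hU hb hb2, hg2.coeFn_toLp] with x h2 h3
      rw [← h2, h3, RCLike.inner_apply]
      simp [mul_comm]

end Superposition

/-! ### Truncations -/

theorem tendsto_eLpNorm_indicator_sub {ν : Measure ℝ} {f : ℝ → ℂ} (hf : MemLp f 2 ν)
    {s : ℝ → Set ℝ} (hs : ∀ R, MeasurableSet (s R)) (h : ∀ x, ∀ᶠ R in atTop, x ∈ s R) :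
    Tendsto (fun R => eLpNorm ((s R).indicator f - f) 2 ν) atTop (𝓝 0) := by
  have h2 : Tendsto (fun R => ∫⁻ x, ‖((s R).indicator f - f) x‖ₑ ^ (2:ℝ) ∂ν) atTop
      (𝓝 (∫⁻ _, 0 ∂ν)) := by
    refine tendsto_lintegral_filter_of_dominated_convergence' (fun x => ‖f x‖ₑ ^ (2:ℝ))
      (Eventually.of_forall fun R => ?_) (Eventually.of_forall fun R => ?_) ?_ ?_
    · exact ((hf.1.indicator (hs R)).sub hf.1).enorm.pow_const _
    · refine Eventually.of_forall fun x => ?_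
      by_cases hx : x ∈ s R <;> simp [hx]
    · have := (eLpNorm_lt_top_iff_lintegral_rpow_enorm_lt_top (p := 2) (by norm_num)
        (by norm_num)).1 hf.2
      simpa using this.ne
    · refine Eventually.of_forall fun x => ?_
      refine tendsto_const_nhds.congr' ?_
      filter_upwards [h x] with R hR
      simp [hR]
  have h3 := ((ENNReal.continuous_rpow_const (y := 1 / 2)).tendsto _).comp h2
  simp only [lintegral_zero] at h3
  rw [ENNReal.zero_rpow_of_pos (by norm_num)] at h3
  refine h3.congr fun R => ?_
  rw [eLpNorm_eq_lintegral_rpow_enorm_toReal (by norm_num) (by norm_num)]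
  simp

/-! ### Completeness from the amplitudes of intervals -/

section Complete

variable {ι : Type*} [Fintype ι] {ψ : ι → ℝ → ℝ → ℂ} {ν : ι → Measure ℝ} {C : ℝ}

/-- An isometry `V` into the Hilbert direct sum satisfies V*V = 1, which reads componentwise as the
stated sum. Surjectivity of `V` plays no role in completeness. -/
theorem exists_resolution_of_identity
    (hE : ∀ i b, MemLp (amplitude (ψ i) ((Ι 0 b).indicator 1)) 2 (ν i))
    (hgram : ∀ a b : ℝ, ∑ i, ∫ k, amplitude (ψ i) ((Ι 0 b).indicator 1) k
      * conj (amplitude (ψ i) ((Ι 0 a).indicator 1) k) ∂(ν i)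
        = (volume.real (Ι 0 a ∩ Ι 0 b) : ℂ)) :
    ∃ U : ∀ i, Lp ℂ 2 (volume : Measure ℝ) →L[ℂ] Lp ℂ 2 (ν i),
      (∀ i b, U i (intervalLp b) =ᵐ[ν i] amplitude (ψ i) ((Ι 0 b).indicator 1)) ∧
      ∀ f, ∑ i, (U i).adjoint (U i f) = f := by
  obtain ⟨U, hU, hUn⟩ := exists_isometry_of_gram_eq (H := Lp ℂ 2 (volume : Measure ℝ))
    (K := PiLp 2 fun i => Lp ℂ 2 (ν i)) intervalLp
    (fun b => WithLp.toLp 2 fun i => (hE i b).toLp) denseRange_linearCombination_intervalLp (by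
      intro a b
      have h1 : ⟪intervalLp a, intervalLp b⟫_ℂ = (volume.real (Ι 0 a ∩ Ι 0 b) : ℂ) := by
        rw [intervalLp, intervalLp, L2.inner_indicatorConstLp_indicatorConstLp _ _ (volume_uIoc_ne_top 0 a)
          (volume_uIoc_ne_top 0 b)]
        simp
      rw [h1, ← hgram, PiLp.inner_apply]
      refine Finset.sum_congr rfl fun i _ => ?_
      rw [L2.inner_def]
      refine integral_congr_ae ?_
      filter_upwards [(hE i a).coeFn_toLp, (hE i b).coeFn_toLp] with k h2 h3
      rw [h2, h3, RCLike.inner_apply])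
  let V : Lp ℂ 2 (volume : Measure ℝ) →ₗᵢ[ℂ] PiLp 2 fun i => Lp ℂ 2 (ν i) := ⟨U.toLinearMap, hUn⟩
  refine ⟨fun i => (PiLp.proj 2 (fun i => Lp ℂ 2 (ν i)) i).comp U, fun i b => ?_, fun f => ?_⟩
  · have h : ((PiLp.proj 2 (fun i => Lp ℂ 2 (ν i)) i).comp U) (intervalLp b) = (hE i b).toLp := by
      simp [hU]
    rw [h]
    exact (hE i b).coeFn_toLp
  · refine ext_inner_left ℂ fun g => ?_
    rw [inner_sum]
    simp only [ContinuousLinearMap.adjoint_inner_right]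
    rw [← V.inner_map_map g f, PiLp.inner_apply]
    rfl

/-- With integrable amplitudes no cutoff in `k` is needed, and the resolution of the identity
becomes an almost everywhere equality of functions. -/
theorem ae_eq_sum_superposition_amplitude [∀ i, SigmaFinite (ν i)]
    (hψ : ∀ i, Measurable (Function.uncurry (ψ i))) (hC : ∀ i k x, ‖ψ i k x‖ ≤ C)
    {U : ∀ i, Lp ℂ 2 (volume : Measure ℝ) →L[ℂ] Lp ℂ 2 (ν i)}
    (hU : ∀ i b, U i (intervalLp b) =ᵐ[ν i] amplitude (ψ i) ((Ι 0 b).indicator 1))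
    (hres : ∀ f, ∑ i, (U i).adjoint (U i f) = f)
    {f : ℝ → ℂ} (hf : Integrable f) (hf2 : MemLp f 2 volume)
    (hi : ∀ i, Integrable (amplitude (ψ i) f) (ν i)) :
    (fun x => ∑ i, ∫ k, amplitude (ψ i) f k * ψ i k x ∂(ν i)) =ᵐ[volume] f := by
  have hae := fun i => amplitude_ae_eq (hψ i) (hC i) (hU i) hf hf2
  have hm : ∀ i, MemLp (amplitude (ψ i) f) 2 (ν i) := fun i =>
    (memLp_congr_ae (hae i)).2 (Lp.memLp _)
  have hS := fun i => superposition_ae_eq_adjoint (hψ i) (hC i) (hU i) (hi i) (hm i)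
  have heq : ∀ i, (hm i).toLp = U i hf2.toLp := fun i => by
    rw [← Lp.toLp_coeFn (U i hf2.toLp) (Lp.memLp _)]
    exact (MemLp.toLp_eq_toLp_iff _ _).2 (hae i)
  have h1 := hres hf2.toLp
  have h2 : ⇑(∑ i, (U i).adjoint (U i hf2.toLp)) =ᵐ[volume] f := by
    rw [h1]; exact hf2.coeFn_toLp
  filter_upwards [h2, Lp.coeFn_fun_finsetSum Finset.univ fun i => (U i).adjoint (U i hf2.toLp),
    ae_all_iff.2 hS] with x h3 h4 h5
  rw [← h3, h4]
  refine Finset.sum_congr rfl fun i _ => ?_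
  rw [h5, heq]

/-- The limiting amplitudes are `U i f`. Truncation to [-R, R] puts `f` in L¹ ∩ L², where `U` is the
integral; cutting at `K` makes `U i f` integrable because `ν i (Set.Iic K)` is finite, so that U* is
the superposition. Both limits are then continuity of `U i` and of its adjoint. -/
theorem isCompleteSystem_of_resolution [∀ i, SigmaFinite (ν i)]
    (hψ : ∀ i, Measurable (Function.uncurry (ψ i))) (hC : ∀ i k x, ‖ψ i k x‖ ≤ C)
    (hfin : ∀ i K, ν i (Set.Iic K) ≠ ⊤)
    {U : ∀ i, Lp ℂ 2 (volume : Measure ℝ) →L[ℂ] Lp ℂ 2 (ν i)}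
    (hU : ∀ i b, U i (intervalLp b) =ᵐ[ν i] amplitude (ψ i) ((Ι 0 b).indicator 1))
    (hres : ∀ f, ∑ i, (U i).adjoint (U i f) = f) :
    IsCompleteSystem ψ ν := by
  intro f hf
  have hb : ∀ i K, MemLp ((Set.Iic K).indicator (U i hf.toLp)) 2 (ν i) := fun i K =>
    (Lp.memLp _).indicator measurableSet_Iic
  have hb1 : ∀ i K, IntegrableOn (U i hf.toLp) (Set.Iic K) (ν i) := fun i K => by
    have : IsFiniteMeasure ((ν i).restrict (Set.Iic K)) := ⟨by simpa using (hfin i K).lt_top⟩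
    exact ((Lp.memLp _).restrict _).integrable (by norm_num)
  refine ⟨fun i => U i hf.toLp, fun i => Lp.memLp _, fun i => ?_, fun i x K => ?_, ?_⟩
  · have hg : ∀ R, MemLp ((Set.Icc (-R) R).indicator f) 2 volume := fun R =>
      hf.indicator measurableSet_Icc
    have hg1 : ∀ R, Integrable ((Set.Icc (-R) R).indicator f) volume := fun R =>
      (integrable_indicator_iff measurableSet_Icc).2
        ((hf.restrict _).integrable (by norm_num))
    have ht := tendsto_eLpNorm_indicator_sub hf (s := fun R => Set.Icc (-R) R)
      (fun R => measurableSet_Icc) fun x => by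
        filter_upwards [eventually_ge_atTop |x|] with R hR
        exact abs_le.1 hR
    have ht2 : Tendsto (fun R => (hg R).toLp) atTop (𝓝 hf.toLp) := by
      rw [Lp.tendsto_Lp_iff_tendsto_eLpNorm'']
      exact ht
    have ht3 := ((U i).continuous.tendsto _).comp ht2
    rw [Lp.tendsto_Lp_iff_tendsto_eLpNorm'] at ht3
    refine ht3.congr fun R => eLpNorm_congr_ae ?_
    filter_upwards [amplitude_ae_eq (hψ i) (hC i) (hU i) (hg1 R) (hg R)] with k hk
    simp [hk]
  · exact integrable_superposition (hψ i) (hC i) (hb1 i K) x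
  · have ht : ∀ i, Tendsto (fun K => (hb i K).toLp) atTop (𝓝 (U i hf.toLp)) := fun i => by
      rw [Lp.tendsto_Lp_iff_tendsto_eLpNorm']
      refine (tendsto_eLpNorm_indicator_sub (Lp.memLp (U i hf.toLp)) (s := fun K => Set.Iic K)
        (fun K => measurableSet_Iic) fun x => eventually_ge_atTop x).congr fun K => ?_
      refine eLpNorm_congr_ae ?_
      filter_upwards [(hb i K).coeFn_toLp] with k hk
      simp [hk]
    have ht2 : Tendsto (fun K => ∑ i, (U i).adjoint (hb i K).toLp) atTop (𝓝 hf.toLp) := by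
      have h := tendsto_finsetSum Finset.univ fun i _ =>
        (((U i).adjoint.continuous.tendsto _).comp (ht i))
      rw [hres] at h
      exact h
    rw [Lp.tendsto_Lp_iff_tendsto_eLpNorm'] at ht2
    refine ht2.congr fun K => eLpNorm_congr_ae ?_
    have hi : ∀ i, Integrable ((Set.Iic K).indicator (U i hf.toLp)) (ν i) := fun i =>
      (integrable_indicator_iff measurableSet_Iic).2 (hb1 i K)
    filter_upwards [Lp.coeFn_fun_finsetSum Finset.univ fun i => (U i).adjoint (hb i K).toLp,
      ae_all_iff.2 fun i => superposition_ae_eq_adjoint (hψ i) (hC i) (hU i) (hi i) (hb i K),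
      hf.coeFn_toLp] with x h1 h2 h3
    simp only [Pi.sub_apply]
    rw [h1, h3]
    congr 1
    refine Finset.sum_congr rfl fun i _ => ?_
    rw [← h2, ← integral_indicator measurableSet_Iic]
    congr 1 with k
    by_cases hk : k ∈ Set.Iic K
    · rw [Set.indicator_of_mem hk, Set.indicator_of_mem hk]
    · rw [Set.indicator_of_notMem hk, Set.indicator_of_notMem hk, zero_mul]

end Complete

/-! ### Integrals along the edge of the first quadrant -/

/-- The closed first quadrant. -/
def closedQuadrant : Set ℂ := Set.Ici 0 ×ℂ Set.Ici 0

/-- The open first quadrant. -/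
def openQuadrant : Set ℂ := Set.Ioi 0 ×ℂ Set.Ioi 0

theorem mem_closedQuadrant {z : ℂ} : z ∈ closedQuadrant ↔ 0 ≤ z.re ∧ 0 ≤ z.im := Iff.rfl

theorem openQuadrant_subset : openQuadrant ⊆ closedQuadrant := fun _ hz =>
  mem_closedQuadrant.2 ⟨le_of_lt hz.1, le_of_lt hz.2⟩

theorem integrableOn_Ioi_of_quadratic_decay {F : ℂ → ℂ} (hc : ContinuousOn F closedQuadrant)
    {C T₀ : ℝ} (hT : 0 < T₀) (hb : ∀ z ∈ closedQuadrant, T₀ ≤ ‖z‖ → ‖F z‖ ≤ C / ‖z‖ ^ 2) :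
    IntegrableOn (fun x : ℝ => F x) (Set.Ioi 0) := by
  have hcx : ContinuousOn (fun x : ℝ => F x) (Set.Ici 0) :=
    hc.comp Complex.continuous_ofReal.continuousOn fun x hx =>
      mem_closedQuadrant.2 ⟨by simpa using hx, by simp⟩
  rw [← Set.Ioc_union_Ioi_eq_Ioi hT.le]
  refine IntegrableOn.union ?_ ?_
  · exact ((hcx.mono Set.Icc_subset_Ici_self).integrableOn_Icc).mono_set Set.Ioc_subset_Icc_self
  · have h0 : 0 ≤ C := by
      have := (norm_nonneg _).trans
        (hb (T₀ : ℂ) (mem_closedQuadrant.2 ⟨by simpa using hT.le, by simp⟩)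
          (by rw [Complex.norm_real]; exact le_abs_self _))
      by_contra hneg
      have h2 : C / ‖(T₀ : ℂ)‖ ^ 2 < 0 := div_neg_of_neg_of_pos (not_le.1 hneg)
        (by rw [Complex.norm_real, Real.norm_eq_abs]; positivity)
      linarith
    -- For x ≥ T₀ one has 1 ≤ x²/T₀², so 1 + x² ≤ (1 + T₀⁻²)x².
    have hg : IntegrableOn (fun x : ℝ => C * (1 + (T₀ ^ 2)⁻¹) * (1 + x ^ 2)⁻¹) (Set.Ioi T₀) :=
      (integrable_inv_one_add_sq.const_mul _).integrableOn
    refine Integrable.mono' hg ((hcx.mono fun x hx => hT.le.trans (le_of_lt hx)).aestronglyMeasurable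
      measurableSet_Ioi) ?_
    filter_upwards [ae_restrict_mem measurableSet_Ioi] with x hx
    have hx' : T₀ < x := hx
    have hx0 : 0 < x := hT.trans hx'
    have hnorm : ‖(x : ℂ)‖ = x := by rw [Complex.norm_real, Real.norm_eq_abs, abs_of_pos hx0]
    have h1 := hb x (mem_closedQuadrant.2 ⟨by simpa using hx0.le, by simp⟩) (by rw [hnorm]; exact hx'.le)
    rw [hnorm] at h1
    refine h1.trans ?_
    rw [mul_assoc, div_eq_mul_inv]
    refine mul_le_mul_of_nonneg_left ?_ h0
    rw [← div_eq_mul_inv, le_div_iff₀ (by positivity), inv_mul_le_iff₀ (by positivity)]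
    have h3 : 1 ≤ (T₀ ^ 2)⁻¹ * x ^ 2 := by
      rw [le_inv_mul_iff₀ (by positivity), mul_one]
      exact pow_le_pow_left₀ hT.le hx'.le 2
    nlinarith

/-- Cauchy's theorem on the square [0, T]². The top and right sides are each at most (C/T²)·T, and
the left side contributes to the imaginary part only through Re F(iy) = 0. -/
theorem integral_im_eq_zero_of_quadrant {F : ℂ → ℂ} (hc : ContinuousOn F closedQuadrant)
    (hd : DifferentiableOn ℂ F openQuadrant) {C T₀ : ℝ} (hT : 0 < T₀)
    (hb : ∀ z ∈ closedQuadrant, T₀ ≤ ‖z‖ → ‖F z‖ ≤ C / ‖z‖ ^ 2)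
    (him : ∀ y : ℝ, 0 < y → (F (y * Complex.I)).re = 0) :
    ∫ x in Set.Ioi (0:ℝ), (F x).im = 0 := by
  have hint := integrableOn_Ioi_of_quadratic_decay hc hT hb
  have hlim := intervalIntegral_tendsto_integral_Ioi 0 hint.im tendsto_id
  refine tendsto_nhds_unique hlim ?_
  have hz : Tendsto (fun T : ℝ => 2 * C * T⁻¹) atTop (𝓝 0) := by
    simpa using tendsto_inv_atTop_zero.const_mul (2 * C)
  refine squeeze_zero_norm' ?_ hz
  filter_upwards [eventually_ge_atTop T₀] with T hTT
  have hT0 : 0 < T := hT.trans_le hTT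
  have hrect := Complex.integral_boundary_rect_eq_zero_of_continuousOn_of_differentiableOn F 0
    (T + T * Complex.I) (hc.mono ?_) (hd.mono ?_)
  rotate_left
  · intro z hz
    have h : z.re ∈ Set.uIcc 0 T ∧ z.im ∈ Set.uIcc 0 T := by simpa [Complex.mem_reProdIm] using hz
    rw [Set.uIcc_of_le hT0.le] at h
    exact ⟨h.1.1, h.2.1⟩
  · intro z hz
    have h : (0 < z.re ∧ z.re < T) ∧ 0 < z.im ∧ z.im < T := by
      simpa [Complex.mem_reProdIm, hT0.le] using hz
    exact ⟨h.1.1, h.2.1⟩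
  simp only [Complex.zero_re, Complex.zero_im, Complex.add_re, Complex.ofReal_re, Complex.mul_re,
    Complex.I_re, mul_zero, Complex.ofReal_im, Complex.I_im, mul_one, sub_self, add_zero,
    Complex.ofReal_zero, zero_mul, Complex.add_im, Complex.mul_im, zero_add, smul_eq_mul] at hrect
  have htop : ‖∫ x in (0:ℝ)..T, F (x + T * Complex.I)‖ ≤ C / T ^ 2 * |T - 0| := by
    refine intervalIntegral.norm_integral_le_of_norm_le_const fun x hx => ?_
    rw [Set.uIoc_of_le hT0.le] at hx
    have hC : 0 ≤ C / ‖(x + T * Complex.I : ℂ)‖ ^ 2 → 0 ≤ C := fun h => by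
      by_contra hneg
      have hpos : 0 < ‖(x + T * Complex.I : ℂ)‖ := norm_pos_iff.2 fun h0 => by
        have := congrArg Complex.re h0; simp at this; linarith [hx.1]
      exact absurd h (not_le.2 (div_neg_of_neg_of_pos (not_le.1 hneg) (by positivity)))
    have hle : T ≤ ‖(x + T * Complex.I : ℂ)‖ := by
      have := Complex.abs_im_le_norm (x + T * Complex.I : ℂ)
      simp only [Complex.add_im, Complex.ofReal_im, Complex.mul_im, Complex.ofReal_re,
        Complex.I_im, mul_one, Complex.I_re, mul_zero, add_zero, zero_add] at this
      exact (le_abs_self T).trans this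
    have h1 := hb (x + T * Complex.I) (mem_closedQuadrant.2 ⟨by simpa using hx.1.le,
      by simpa using hT0.le⟩) (hTT.trans hle)
    have h2 := hC ((norm_nonneg _).trans h1)
    exact h1.trans (div_le_div_of_nonneg_left h2 (by positivity) (pow_le_pow_left₀ hT0.le hle 2))
  have hside : ‖∫ y in (0:ℝ)..T, F (T + y * Complex.I)‖ ≤ C / T ^ 2 * |T - 0| := by
    refine intervalIntegral.norm_integral_le_of_norm_le_const fun x hx => ?_
    rw [Set.uIoc_of_le hT0.le] at hx
    have hC : 0 ≤ C / ‖(T + x * Complex.I : ℂ)‖ ^ 2 → 0 ≤ C := fun h => by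
      by_contra hneg
      have hpos : 0 < ‖(T + x * Complex.I : ℂ)‖ := norm_pos_iff.2 fun h0 => by
        have := congrArg Complex.re h0; simp at this; linarith [hx.1]
      exact absurd h (not_le.2 (div_neg_of_neg_of_pos (not_le.1 hneg) (by positivity)))
    have hle : T ≤ ‖(T + x * Complex.I : ℂ)‖ := by
      have := Complex.abs_re_le_norm (T + x * Complex.I : ℂ)
      simp only [Complex.add_re, Complex.ofReal_im, Complex.mul_re, Complex.ofReal_re,
        Complex.I_im, mul_one, Complex.I_re, mul_zero, add_zero, sub_self] at this
      exact (le_abs_self T).trans this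
    have h1 := hb (T + x * Complex.I) (mem_closedQuadrant.2 ⟨by simpa using hT0.le,
      by simpa using hx.1.le⟩) (hTT.trans hle)
    have h2 := hC ((norm_nonneg _).trans h1)
    exact h1.trans (div_le_div_of_nonneg_left h2 (by positivity) (pow_le_pow_left₀ hT0.le hle 2))
  have hintT : IntervalIntegrable (fun x : ℝ => F x) volume 0 T :=
    (intervalIntegrable_iff_integrableOn_Ioc_of_le hT0.le).2
      (hint.mono_set Set.Ioc_subset_Ioi_self)
  have hbot : ∫ x in (0:ℝ)..T, (F x).im = (∫ x in (0:ℝ)..T, F x).im :=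
    Complex.imCLM.intervalIntegral_comp_comm hintT
  have hleft : (∫ y in (0:ℝ)..T, F (y * Complex.I)).re = 0 := by
    have hi : IntervalIntegrable (fun y : ℝ => F (y * Complex.I)) volume 0 T := by
      refine ContinuousOn.intervalIntegrable ?_
      refine hc.comp (by fun_prop) fun y hy => ?_
      rw [Set.uIcc_of_le hT0.le] at hy
      exact mem_closedQuadrant.2 ⟨by simp, by simpa using hy.1⟩
    have h := Complex.reCLM.intervalIntegral_comp_comm hi
    simp only [Complex.reCLM_apply] at h
    rw [← h]
    refine intervalIntegral.integral_zero_ae (Eventually.of_forall fun y hy => ?_)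
    rw [Set.uIoc_of_le hT0.le] at hy
    exact him y hy.1
  have him' := congrArg Complex.im hrect
  simp only [Complex.add_im, Complex.sub_im, Complex.mul_im, Complex.I_re, Complex.I_im,
    zero_mul, one_mul, zero_add, hleft, Complex.zero_im, sub_zero] at him'
  change ‖∫ x in (0:ℝ)..T, (F x).im‖ ≤ _
  rw [hbot, Real.norm_eq_abs]
  rw [sub_zero, abs_of_pos hT0] at htop hside
  have e : C / T ^ 2 * T = C * T⁻¹ := by field_simp
  rw [e] at htop hside
  have h1 := (Complex.abs_im_le_norm _).trans htop
  have h2 := (Complex.abs_re_le_norm _).trans hside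
  rw [abs_le] at *
  constructor <;> linarith [h1.1, h1.2, h2.1, h2.2]

/-- `J` alone decays too slowly for the far sides of the square to vanish. The term m/(z + i)
cancels its leading part -m/z, has no pole in the quadrant and is imaginary on the imaginary axis;
on the real axis its imaginary part is -m/(1 + x²), which accounts for mπ/2. -/
theorem integral_im_eq_of_quadrant {J : ℂ → ℂ} (hc : ContinuousOn J closedQuadrant)
    (hd : DifferentiableOn ℂ J openQuadrant) {m C T₀ : ℝ} (hT : 0 < T₀)
    (hb : ∀ z ∈ closedQuadrant, T₀ ≤ ‖z‖ → ‖J z + m / z‖ ≤ C / ‖z‖ ^ 2)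
    (him : ∀ y : ℝ, 0 < y → (J (y * Complex.I)).re = 0) :
    IntegrableOn (fun x : ℝ => (J x).im) (Set.Ioi 0) ∧
      ∫ x in Set.Ioi (0:ℝ), (J x).im = m * (Real.pi / 2) := by
  have hne : ∀ z : ℂ, 0 ≤ z.im → z + Complex.I ≠ 0 := fun z hz h => by
    have := congrArg Complex.im h
    simp at this; linarith
  set F : ℂ → ℂ := fun z => J z + m / (z + Complex.I) with hF
  have hFc : ContinuousOn F closedQuadrant :=
    hc.add (continuousOn_const.div (by fun_prop) fun z hz => hne z hz.2)
  have hFd : DifferentiableOn ℂ F openQuadrant :=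
    hd.add ((differentiableOn_const _).div (by fun_prop) fun z hz =>
      hne z (openQuadrant_subset hz).2)
  have hFb : ∀ z ∈ closedQuadrant, T₀ ≤ ‖z‖ → ‖F z‖ ≤ (C + |m|) / ‖z‖ ^ 2 := by
    intro z hz hTz
    have hzn : 0 < ‖z‖ := hT.trans_le hTz
    have hz0 : z ≠ 0 := norm_pos_iff.1 hzn
    have h1 := hne z hz.2
    -- The correction m/(z + i) differs from m/z by a term of size at most |m|/|z|², since |z + i| ≥
    -- |z| when Im z ≥ 0.
    have h2 : F z = (J z + m / z) - m * Complex.I / (z * (z + Complex.I)) := by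
      simp only [hF]; field_simp; ring
    have h3 : ‖z‖ ≤ ‖z + Complex.I‖ := by
      rw [← sq_le_sq₀ (norm_nonneg _) (norm_nonneg _), ← Complex.normSq_eq_norm_sq,
        ← Complex.normSq_eq_norm_sq, Complex.normSq_apply, Complex.normSq_apply]
      have : 0 ≤ z.im := hz.2
      simp; nlinarith
    rw [h2, add_div]
    refine (norm_sub_le _ _).trans (add_le_add (hb z hz hTz) ?_)
    rw [norm_div, norm_mul, norm_mul, Complex.norm_I, mul_one, Complex.norm_real,
      Real.norm_eq_abs, sq]
    gcongr
  have hFim : ∀ y : ℝ, 0 < y → (F (y * Complex.I)).re = 0 := by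
    intro y hy
    have : (m : ℂ) / (y * Complex.I + Complex.I) = ((-(m / (y + 1)) : ℝ) : ℂ) * Complex.I := by
      have h1 := hne (y * Complex.I) (by simpa using hy.le)
      have h2 : (y : ℂ) + 1 ≠ 0 := by exact_mod_cast (by linarith : (y : ℝ) + 1 ≠ 0)
      push_cast
      field_simp
      linear_combination (m : ℂ) * Complex.I_sq
    simp only [hF, Complex.add_re, him y hy, this, Complex.re_ofReal_mul, Complex.I_re, mul_zero,
      add_zero]
  have hzero := integral_im_eq_zero_of_quadrant hFc hFd hT hFb hFim
  have hFi : IntegrableOn (fun x : ℝ => (F x).im) (Set.Ioi 0) :=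
    (integrableOn_Ioi_of_quadratic_decay hFc hT hFb).im
  have hmi : IntegrableOn (fun x : ℝ => m * (1 + x ^ 2)⁻¹) (Set.Ioi 0) :=
    (integrable_inv_one_add_sq.const_mul _).integrableOn
  have heq : (fun x : ℝ => (J x).im) = fun x : ℝ => (F x).im + m * (1 + x ^ 2)⁻¹ := by
    funext x
    have : (m : ℂ) / (x + Complex.I) = ((m * x / (1 + x ^ 2) : ℝ) : ℂ)
        - ((m * (1 + x ^ 2)⁻¹ : ℝ) : ℂ) * Complex.I := by
      have h1 := hne (x : ℂ) (by simp)
      have h2 : (1 : ℂ) + x ^ 2 ≠ 0 := by exact_mod_cast (by positivity : (1 : ℝ) + x ^ 2 ≠ 0)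
      push_cast
      field_simp
      linear_combination (m : ℂ) * Complex.I_sq
    simp only [hF, Complex.add_im, this, Complex.sub_im, Complex.ofReal_im, Complex.im_ofReal_mul,
      Complex.I_im]
    ring
  rw [heq]
  refine ⟨hFi.add hmi, ?_⟩
  rw [integral_add hFi hmi, integral_const_mul, integral_Ioi_inv_one_add_sq, hzero]
  simp

/-! ### The wave number on the right -/

/-- The closed quadrant meets its negative only at 0, so a square root in it is unique. This is how
`waveNumber` is evaluated on the two axes. -/
theorem eq_of_sq_eq_sq_of_mem_closedQuadrant {z w : ℂ} (hz : z ∈ closedQuadrant)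
    (hw : w ∈ closedQuadrant) (h : z ^ 2 = w ^ 2) : z = w := by
  rcases sq_eq_sq_iff_eq_or_eq_neg.1 h with h | h
  · exact h
  · have h1 := congrArg Complex.re h
    have h2 := congrArg Complex.im h
    rw [Complex.neg_re] at h1
    rw [Complex.neg_im] at h2
    obtain ⟨hz1, hz2⟩ := mem_closedQuadrant.1 hz
    obtain ⟨hw1, hw2⟩ := mem_closedQuadrant.1 hw
    apply Complex.ext <;> linarith

/-- The square root of `k² - v²`, holomorphic in the open first quadrant. -/
noncomputable def waveNumber (v : ℝ) (k : ℂ) : ℂ := (k ^ 2 - v ^ 2) ^ (2⁻¹ : ℂ)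

theorem waveNumber_sq (v : ℝ) (k : ℂ) : waveNumber v k ^ 2 = k ^ 2 - v ^ 2 := by
  have := Complex.cpow_nat_inv_pow (k ^ 2 - (v : ℂ) ^ 2) (n := 2) (by norm_num)
  simpa only [waveNumber, Nat.cast_ofNat] using this

theorem im_sq_sub_ofReal_sq (v : ℝ) (k : ℂ) : (k ^ 2 - (v : ℂ) ^ 2).im = 2 * (k.re * k.im) := by
  rw [← Complex.ofReal_pow, Complex.sub_im, Complex.ofReal_im, sq, Complex.mul_im]; ring

theorem waveNumber_mem_closedQuadrant (v : ℝ) {k : ℂ} (hk : k ∈ closedQuadrant) :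
    waveNumber v k ∈ closedQuadrant := by
  refine mem_closedQuadrant.2 ⟨?_, ?_⟩
  · rw [waveNumber, Complex.cpow_inv_two_re]; positivity
  · rw [waveNumber, Complex.cpow_inv_two_im_eq_sqrt]
    · positivity
    · rw [im_sq_sub_ofReal_sq]
      exact mul_nonneg zero_le_two (mul_nonneg hk.1 hk.2)

/-- The edge points k ∈ [0, v) and k = iy map to the cut of the principal root. On the quadrant k² -
v² stays in the closed upper half-plane, where the real and imaginary parts of the root are real
square roots of continuous functions. -/
theorem continuousOn_waveNumber (v : ℝ) : ContinuousOn (waveNumber v) closedQuadrant := by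
  have h : ContinuousOn (fun k : ℂ =>
      ((√((‖k ^ 2 - (v : ℂ) ^ 2‖ + (k ^ 2 - (v : ℂ) ^ 2).re) / 2) : ℝ) : ℂ)
      + ((√((‖k ^ 2 - (v : ℂ) ^ 2‖ - (k ^ 2 - (v : ℂ) ^ 2).re) / 2) : ℝ) : ℂ) * Complex.I)
      closedQuadrant := by
    have hre : Continuous fun k : ℂ => (k ^ 2 - (v : ℂ) ^ 2).re :=
      Complex.continuous_re.comp (by fun_prop)
    fun_prop
  refine h.congr fun k hk => ?_
  have him : 0 ≤ (k ^ 2 - (v : ℂ) ^ 2).im := by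
    rw [im_sq_sub_ofReal_sq]
    exact mul_nonneg zero_le_two (mul_nonneg hk.1 hk.2)
  dsimp only
  rw [← Complex.cpow_inv_two_re, ← Complex.cpow_inv_two_im_eq_sqrt him, Complex.re_add_im,
    waveNumber]

theorem differentiableOn_waveNumber (v : ℝ) :
    DifferentiableOn ℂ (waveNumber v) openQuadrant := by
  intro k hk
  refine DifferentiableAt.differentiableWithinAt ?_
  refine DifferentiableAt.cpow (by fun_prop) (by fun_prop) (Or.inr ?_)
  rw [im_sq_sub_ofReal_sq]
  exact (mul_pos two_pos (mul_pos hk.1 hk.2)).ne'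

/-- The product (k - w)(k + w) equals v², which is not zero. Physically, the step has no bound
states and the resolvent no poles. -/
theorem add_waveNumber_ne_zero {v : ℝ} (hv : 0 < v) (k : ℂ) :
    k + waveNumber v k ≠ 0 := by
  intro h
  have h1 := congrArg (fun z => (k - waveNumber v k) * z) h
  have h2 : (k - waveNumber v k) * (k + waveNumber v k) = (v : ℂ) ^ 2 := by
    linear_combination -waveNumber_sq v k
  simp only [h2, mul_zero] at h1
  exact hv.ne' (by exact_mod_cast pow_eq_zero_iff (two_ne_zero) |>.1 h1)

theorem norm_sq_eq_re_im (z : ℂ) : ‖z‖ ^ 2 = z.re ^ 2 + z.im ^ 2 := by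
  rw [← Complex.normSq_eq_norm_sq, Complex.normSq_apply]; ring

theorem norm_le_norm_add_of_mem_closedQuadrant {z w : ℂ} (hz : z ∈ closedQuadrant)
    (hw : w ∈ closedQuadrant) : ‖z‖ ≤ ‖z + w‖ := by
  obtain ⟨hz1, hz2⟩ := mem_closedQuadrant.1 hz
  obtain ⟨hw1, hw2⟩ := mem_closedQuadrant.1 hw
  rw [← sq_le_sq₀ (norm_nonneg _) (norm_nonneg _), norm_sq_eq_re_im, norm_sq_eq_re_im,
    Complex.add_re, Complex.add_im]
  nlinarith [mul_nonneg hz1 hw1, mul_nonneg hz2 hw2, sq_nonneg w.re, sq_nonneg w.im]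

/-- Two points of the quadrant form an angle of at most π/2. Applied to k and its wave number on the
right, this bounds the reflection coefficient by 1. -/
theorem norm_sub_le_norm_add_of_mem_closedQuadrant {z w : ℂ} (hz : z ∈ closedQuadrant)
    (hw : w ∈ closedQuadrant) : ‖z - w‖ ≤ ‖z + w‖ := by
  obtain ⟨hz1, hz2⟩ := mem_closedQuadrant.1 hz
  obtain ⟨hw1, hw2⟩ := mem_closedQuadrant.1 hw
  rw [← sq_le_sq₀ (norm_nonneg _) (norm_nonneg _), norm_sq_eq_re_im, norm_sq_eq_re_im,
    Complex.add_re, Complex.add_im, Complex.sub_re, Complex.sub_im]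
  nlinarith [mul_nonneg hz1 hw1, mul_nonneg hz2 hw2]

theorem norm_div_add_waveNumber_le_one {v : ℝ} {k : ℂ} (hk : k ∈ closedQuadrant) :
    ‖k / (k + waveNumber v k)‖ ≤ 1 := by
  rw [norm_div]
  exact div_le_one_of_le₀ (norm_le_norm_add_of_mem_closedQuadrant hk
    (waveNumber_mem_closedQuadrant v hk)) (norm_nonneg _)

theorem norm_le_two_mul_norm_waveNumber {v : ℝ} (hv : 0 < v) {k : ℂ} (hk : 2 * v ≤ ‖k‖) :
    ‖k‖ ≤ 2 * ‖waveNumber v k‖ := by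
  have h1 : ‖k‖ ^ 2 ≤ ‖waveNumber v k‖ ^ 2 + v ^ 2 := by
    have h : k ^ 2 = waveNumber v k ^ 2 + (v : ℂ) ^ 2 := by rw [waveNumber_sq]; ring
    have h2 := norm_add_le (waveNumber v k ^ 2) ((v : ℂ) ^ 2)
    rw [← h, norm_pow, norm_pow, norm_pow, Complex.norm_real, Real.norm_eq_abs, sq_abs] at h2
    exact h2
  by_contra! hlt
  nlinarith [norm_nonneg (waveNumber v k), norm_nonneg k]

theorem waveNumber_ofReal_of_lt {v k : ℝ} (hv : 0 < v) (hk : v < k) :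
    waveNumber v k = (√(k ^ 2 - v ^ 2) : ℝ) := by
  have h : 0 ≤ k ^ 2 - v ^ 2 := by nlinarith
  refine eq_of_sq_eq_sq_of_mem_closedQuadrant (waveNumber_mem_closedQuadrant v
    (mem_closedQuadrant.2 ⟨by simpa using (hv.trans hk).le, by simp⟩))
    (mem_closedQuadrant.2 ⟨by simp, by simp⟩) ?_
  rw [waveNumber_sq, ← Complex.ofReal_pow (√(k ^ 2 - v ^ 2)), Real.sq_sqrt h]
  push_cast; ring

theorem waveNumber_ofReal_of_gt {v k : ℝ} (hk0 : 0 < k) (hk : k < v) :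
    waveNumber v k = (√(v ^ 2 - k ^ 2) : ℝ) * Complex.I := by
  have h : 0 ≤ v ^ 2 - k ^ 2 := by nlinarith
  refine eq_of_sq_eq_sq_of_mem_closedQuadrant (waveNumber_mem_closedQuadrant v
    (mem_closedQuadrant.2 ⟨by simpa using hk0.le, by simp⟩))
    (mem_closedQuadrant.2 ⟨by simp, by simp⟩) ?_
  rw [waveNumber_sq, mul_pow, ← Complex.ofReal_pow (√(v ^ 2 - k ^ 2)), Real.sq_sqrt h, Complex.I_sq]
  push_cast; ring

theorem waveNumber_mul_I {v y : ℝ} (hy : 0 < y) :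
    waveNumber v (y * Complex.I) = (√(y ^ 2 + v ^ 2) : ℝ) * Complex.I := by
  have h : 0 ≤ y ^ 2 + v ^ 2 := by positivity
  refine eq_of_sq_eq_sq_of_mem_closedQuadrant (waveNumber_mem_closedQuadrant v
    (mem_closedQuadrant.2 ⟨by simp, by simpa using hy.le⟩))
    (mem_closedQuadrant.2 ⟨by simp, by simp⟩) ?_
  rw [waveNumber_sq, mul_pow, mul_pow, ← Complex.ofReal_pow (√(y ^ 2 + v ^ 2)), Real.sq_sqrt h,
    Complex.I_sq]
  push_cast; ring

/-! ### Integrals of exponentials -/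

/-- The entire function `(exp z - 1) / z`. -/
noncomputable def expSlope (z : ℂ) : ℂ := dslope Complex.exp 0 z

/-- The entire function `(exp z - 1 - z) / z²`. -/
noncomputable def expSlope₂ (z : ℂ) : ℂ := dslope expSlope 0 z

theorem Differentiable.dslope_complex {f : ℂ → ℂ} (hf : Differentiable ℂ f) (c : ℂ) :
    Differentiable ℂ (dslope f c) := by
  rw [← differentiableOn_univ] at hf ⊢
  exact (Complex.differentiableOn_dslope univ_mem).2 hf

theorem differentiable_expSlope : Differentiable ℂ expSlope :=
  Complex.differentiable_exp.dslope_complex 0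

theorem differentiable_expSlope₂ : Differentiable ℂ expSlope₂ :=
  differentiable_expSlope.dslope_complex 0

theorem expSlope_zero : expSlope 0 = 1 := by
  rw [expSlope, dslope_same]; simp

theorem mul_expSlope (z : ℂ) : z * expSlope z = Complex.exp z - 1 := by
  have := sub_smul_dslope Complex.exp 0 z
  simpa [expSlope] using this

theorem mul_expSlope₂ (z : ℂ) : z * expSlope₂ z = expSlope z - 1 := by
  have := sub_smul_dslope expSlope 0 z
  simpa [expSlope₂, expSlope_zero] using this

/-- Differentiating z · `expSlope` z = exp z - 1 twice at 0 gives twice the derivative of `expSlope`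
at 0 equal to 1. -/
theorem expSlope₂_zero : expSlope₂ 0 = 1 / 2 := by
  have hd2 : Differentiable ℂ (deriv expSlope) := fun z =>
    (differentiable_expSlope.contDiff (n := 2)).differentiable_deriv_two z
  have h1 : ∀ z, expSlope z + z * deriv expSlope z = Complex.exp z := by
    intro z
    have ha := (hasDerivAt_id z).mul (differentiable_expSlope z).hasDerivAt
    have hb := (Complex.hasDerivAt_exp z).sub_const 1
    have he : (id * expSlope : ℂ → ℂ) = fun z => Complex.exp z - 1 := funext mul_expSlope
    rw [he] at ha
    have := ha.unique hb
    simpa using this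
  have ha := ((differentiable_expSlope 0).hasDerivAt).add
    ((hasDerivAt_id (0:ℂ)).mul (hd2 0).hasDerivAt)
  have he : (expSlope + id * deriv expSlope : ℂ → ℂ) = Complex.exp := funext h1
  rw [he] at ha
  have := ha.unique (Complex.hasDerivAt_exp 0)
  simp only [one_mul, id, zero_mul, add_zero, Complex.exp_zero] at this
  rw [expSlope₂, dslope_same]
  linear_combination this / 2

/-- The integral of `exp (i w s)` over `0 < s < a`. -/
noncomputable def expE (a : ℝ) (w : ℂ) : ℂ := a * expSlope (Complex.I * w * a)

/-- The second antiderivative in `a` of `exp (i w a)` that vanishes to second order at `0`. -/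
noncomputable def expH (a : ℝ) (w : ℂ) : ℂ := a ^ 2 * expSlope₂ (Complex.I * w * a)

theorem differentiable_expE (a : ℝ) : Differentiable ℂ (expE a) :=
  (differentiable_expSlope.comp (by fun_prop)).const_mul _

theorem differentiable_expH (a : ℝ) : Differentiable ℂ (expH a) :=
  (differentiable_expSlope₂.comp (by fun_prop)).const_mul _

theorem expE_of_ne {w : ℂ} (hw : w ≠ 0) (a : ℝ) :
    expE a w = (Complex.exp (Complex.I * w * a) - 1) / (Complex.I * w) := by
  rw [eq_div_iff (mul_ne_zero Complex.I_ne_zero hw), ← mul_expSlope, expE]; ring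

theorem expH_of_ne {w : ℂ} (hw : w ≠ 0) (a : ℝ) :
    expH a w = (1 + Complex.I * w * a - Complex.exp (Complex.I * w * a)) / w ^ 2 := by
  rw [eq_div_iff (pow_ne_zero 2 hw), expH]
  have h1 := mul_expSlope (Complex.I * w * a)
  have h2 := mul_expSlope₂ (Complex.I * w * a)
  have h3 := Complex.I_sq
  linear_combination (-(Complex.I * w * a)) * h2 - h1
    + (a ^ 2 * expSlope₂ (Complex.I * w * a) * w ^ 2) * h3

theorem norm_exp_I_mul_le_one {w : ℂ} (hw : 0 ≤ w.im) {a : ℝ} (ha : 0 ≤ a) :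
    ‖Complex.exp (Complex.I * w * a)‖ ≤ 1 := by
  rw [Complex.norm_exp, Real.exp_le_one_iff]
  have : (Complex.I * w * a).re = -(w.im * a) := by simp
  rw [this]
  exact neg_nonpos.2 (mul_nonneg hw ha)

theorem norm_exp_sub_one_le_two {w : ℂ} (hw : 0 ≤ w.im) {a : ℝ} (ha : 0 ≤ a) :
    ‖Complex.exp (Complex.I * w * a) - 1‖ ≤ 2 := by
  have := norm_sub_le (Complex.exp (Complex.I * w * a)) 1
  rw [norm_one] at this
  linarith [norm_exp_I_mul_le_one hw ha]

theorem norm_expE_le {w : ℂ} (hw : 0 ≤ w.im) (hw0 : w ≠ 0) {a : ℝ} (ha : 0 ≤ a) :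
    ‖expE a w‖ ≤ 2 / ‖w‖ := by
  rw [expE_of_ne hw0, norm_div, norm_mul, Complex.norm_I, one_mul]
  gcongr
  exact norm_exp_sub_one_le_two hw ha

/-- The double integral of `exp (i w |s - t|)` over `0 < s < a`, `0 < t < b`. -/
noncomputable def expD (a b : ℝ) (w : ℂ) : ℂ := expH a w + expH b w - expH |a - b| w

theorem differentiable_expD (a b : ℝ) : Differentiable ℂ (expD a b) :=
  ((differentiable_expH a).add (differentiable_expH b)).sub (differentiable_expH _)

theorem two_mul_min (a b : ℝ) : 2 * min a b = a + b - |a - b| := by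
  rcases le_total a b with h | h
  · rw [min_eq_left h, abs_of_nonpos (by linarith)]; ring
  · rw [min_eq_right h, abs_of_nonneg (by linarith)]; ring

/-- The linear terms of the three `expH` add up to iw(a + b - |a - b|) = 2iw min(a, b). What remains
over w² is four terms of modulus at most 1. -/
theorem norm_expD_sub_le {w : ℂ} (hw : 0 ≤ w.im) (hw0 : w ≠ 0) {a b : ℝ} (ha : 0 ≤ a)
    (hb : 0 ≤ b) : ‖expD a b w - 2 * Complex.I * (min a b : ℝ) / w‖ ≤ 4 / ‖w‖ ^ 2 := by
  have h : expD a b w - 2 * Complex.I * (min a b : ℝ) / w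
      = (1 - Complex.exp (Complex.I * w * a) - (Complex.exp (Complex.I * w * b)
        - Complex.exp (Complex.I * w * |a - b|))) / w ^ 2 := by
    have hm : (2 * (min a b : ℝ) : ℂ) = a + b - (|a - b| : ℝ) := by exact_mod_cast two_mul_min a b
    rw [expD, expH_of_ne hw0, expH_of_ne hw0, expH_of_ne hw0]
    field_simp
    linear_combination (-(w * Complex.I)) * hm
  rw [h, norm_div, norm_pow]
  gcongr
  have h1 := norm_exp_sub_one_le_two hw ha
  rw [norm_sub_rev] at h1
  have h2 := norm_sub_le (Complex.exp (Complex.I * w * b)) (Complex.exp (Complex.I * w * |a - b|))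
  have h3 := norm_exp_I_mul_le_one hw hb
  have h4 := norm_exp_I_mul_le_one hw (abs_nonneg (a - b))
  refine (norm_sub_le _ _).trans ?_
  linarith

/-- The integral of `cos (k s)` over `0 < s < a`. -/
noncomputable def cosInt (k a : ℝ) : ℝ := Real.sin (k * a) / k

/-- The integral of `sin (k s)` over `0 < s < a`. -/
noncomputable def sinInt (k a : ℝ) : ℝ := (1 - Real.cos (k * a)) / k

/-- The integral of `exp (-α s)` over `0 < s < a`. -/
noncomputable def decayInt (α a : ℝ) : ℝ := (1 - Real.exp (-(α * a))) / α

theorem expE_ofReal {k : ℝ} (hk : k ≠ 0) (a : ℝ) :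
    expE a k = (cosInt k a : ℂ) + (sinInt k a : ℂ) * Complex.I := by
  rw [cosInt, sinInt]
  have hk' : (k : ℂ) ≠ 0 := by exact_mod_cast hk
  rw [expE_of_ne hk', mul_assoc, mul_comm Complex.I ((k : ℂ) * a), ← Complex.ofReal_mul,
    Complex.exp_mul_I, ← Complex.ofReal_cos, ← Complex.ofReal_sin]
  push_cast
  have := Complex.I_ne_zero
  field_simp
  linear_combination (Complex.cos (k * a) - 1) * Complex.I_sq

/-- For real `k` the real part of exp(ik|s - t|) is cos(ks)cos(kt) + sin(ks)sin(kt), integrated over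
both variables. -/
theorem re_expD_ofReal {k : ℝ} (hk : k ≠ 0) (a b : ℝ) :
    (expD a b k).re = cosInt k a * cosInt k b + sinInt k a * sinInt k b := by
  simp only [cosInt, sinInt]
  have hk' : (k : ℂ) ≠ 0 := by exact_mod_cast hk
  have hH : ∀ a : ℝ, (expH a k).re = (1 - Real.cos (k * a)) / k ^ 2 := by
    intro a
    rw [expH_of_ne hk', mul_assoc, mul_comm Complex.I ((k : ℂ) * a), ← Complex.ofReal_mul,
      Complex.exp_mul_I, ← Complex.ofReal_cos, ← Complex.ofReal_sin, ← Complex.ofReal_pow,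
      Complex.div_ofReal_re]
    congr 1
    simp only [Complex.sub_re, Complex.add_re, Complex.one_re, Complex.mul_re,
      Complex.I_re, Complex.I_im, Complex.ofReal_re, Complex.ofReal_im]
    ring
  have hc : Real.cos (k * |a - b|) = Real.cos (k * a) * Real.cos (k * b)
      + Real.sin (k * a) * Real.sin (k * b) := by
    rw [← Real.cos_sub, ← mul_sub]
    rcases abs_choice (a - b) with h | h <;> rw [h]
    rw [mul_neg, Real.cos_neg]
  rw [expD, Complex.sub_re, Complex.add_re, hH, hH, hH, hc]
  field_simp
  ring

theorem expE_mul_I {y : ℝ} (hy : y ≠ 0) (a : ℝ) :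
    expE a (y * Complex.I) = ((1 - Real.exp (-(y * a))) / y : ℝ) := by
  have hy' : (y : ℂ) ≠ 0 := by exact_mod_cast hy
  have h : Complex.I * (y * Complex.I) * a = ((-(y * a) : ℝ) : ℂ) := by
    push_cast; linear_combination (y * a : ℂ) * Complex.I_sq
  rw [expE_of_ne (mul_ne_zero hy' Complex.I_ne_zero), h, ← Complex.ofReal_exp]
  have h2 : Complex.I * (y * Complex.I) = -y := by linear_combination (y : ℂ) * Complex.I_sq
  rw [h2]
  push_cast
  field_simp
  ring

theorem expH_mul_I {y : ℝ} (hy : y ≠ 0) (a : ℝ) :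
    expH a (y * Complex.I) = (-(1 - y * a - Real.exp (-(y * a))) / y ^ 2 : ℝ) := by
  have hy' : (y : ℂ) ≠ 0 := by exact_mod_cast hy
  have h : Complex.I * (y * Complex.I) * a = ((-(y * a) : ℝ) : ℂ) := by
    push_cast; linear_combination (y * a : ℂ) * Complex.I_sq
  rw [expH_of_ne (mul_ne_zero hy' Complex.I_ne_zero), h, ← Complex.ofReal_exp, mul_pow,
    Complex.I_sq]
  push_cast
  field_simp
  ring

theorem exists_expD_mul_I {y : ℝ} (hy : y ≠ 0) (a b : ℝ) :
    ∃ d : ℝ, expD a b (y * Complex.I) = d :=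
  ⟨_, by rw [expD, expH_mul_I hy, expH_mul_I hy, expH_mul_I hy, ← Complex.ofReal_add,
    ← Complex.ofReal_sub]⟩

/-- The quotient `(expD a b w - expE a w * expE b w) / w`, which is entire in `w`. -/
noncomputable def expQ (a b : ℝ) (w : ℂ) : ℂ :=
  dslope (fun w => expD a b w - expE a w * expE b w) 0 w

theorem differentiable_expQ (a b : ℝ) : Differentiable ℂ (expQ a b) :=
  Differentiable.dslope_complex ((differentiable_expD a b).sub
    ((differentiable_expE a).mul (differentiable_expE b))) 0

theorem expQ_of_ne {w : ℂ} (hw : w ≠ 0) (a b : ℝ) :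
    expQ a b w = (expD a b w - expE a w * expE b w) / w := by
  -- Both terms equal ab at w = 0, so the singularity of the quotient is removable.
  have h0 : expD a b 0 - expE a 0 * expE b 0 = 0 := by
    have habs : ((|a - b| : ℝ) : ℂ) ^ 2 = (a - b) ^ 2 := by exact_mod_cast sq_abs (a - b)
    simp only [expD, expH, expE, mul_zero, zero_mul, expSlope_zero, expSlope₂_zero]
    rw [habs]; ring
  rw [expQ, dslope_of_ne _ hw, slope_def_field, h0, sub_zero, sub_zero]

/-! ### The integrated resolvent kernel of the step -/

/-- `k` times the resolvent kernel, integrated over depths up to `a` and `b`, both on the left. -/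
noncomputable def leftResolvent (v a b : ℝ) (k : ℂ) : ℂ :=
  Complex.I / 2 * (expD a b k
    + (k - waveNumber v k) / (k + waveNumber v k) * (expE a k * expE b k))

/-- `k` times the resolvent kernel, integrated over depths up to `a` and `b`, both on the right. -/
noncomputable def rightResolvent (v a b : ℝ) (k : ℂ) : ℂ :=
  Complex.I * k / 2 * expQ a b (waveNumber v k)
    + Complex.I * (k / (k + waveNumber v k))
      * (expE a (waveNumber v k) * expE b (waveNumber v k))

/-- `k` times the resolvent kernel, integrated over depths up to `a` on the left and up to `b` on
the right. -/
noncomputable def crossResolvent (v a b : ℝ) (k : ℂ) : ℂ :=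
  Complex.I * (k / (k + waveNumber v k)) * (expE a k * expE b (waveNumber v k))

/-! ### Holomorphy in the open quadrant and continuity up to its edge. -/

section Regularity

variable {v : ℝ} (hv : 0 < v) (a b : ℝ)
include hv

theorem continuousOn_leftResolvent : ContinuousOn (leftResolvent v a b) closedQuadrant := by
  have hw := continuousOn_waveNumber v
  have h1 := (differentiable_expD a b).continuous.continuousOn (s := closedQuadrant)
  have h2 := (differentiable_expE a).continuous.continuousOn (s := closedQuadrant)
  have h3 := (differentiable_expE b).continuous.continuousOn (s := closedQuadrant)
  exact continuousOn_const.mul (h1.add (((continuousOn_id.sub hw).div (continuousOn_id.add hw)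
    fun z _ => add_waveNumber_ne_zero hv z).mul (h2.mul h3)))

theorem differentiableOn_leftResolvent :
    DifferentiableOn ℂ (leftResolvent v a b) openQuadrant := by
  have hw := differentiableOn_waveNumber v
  have h1 := (differentiable_expD a b).differentiableOn (s := openQuadrant)
  have h2 := (differentiable_expE a).differentiableOn (s := openQuadrant)
  have h3 := (differentiable_expE b).differentiableOn (s := openQuadrant)
  exact (differentiableOn_const _).mul (h1.add (((differentiableOn_id.sub hw).div
    (differentiableOn_id.add hw) fun z _ => add_waveNumber_ne_zero hv z).mul (h2.mul h3)))

/-- With w the wave number on the right, the integrated kernel is naturally (ik/2w)(D + ((w - k)/(w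
+ k))EE), apparently singular at the threshold w = 0. Writing (w - k)/(w + k) = -1 + 2w/(k + w)
collects the singularity in (D - EE)/w, which is the entire function `expQ`. -/
theorem continuousOn_rightResolvent : ContinuousOn (rightResolvent v a b) closedQuadrant := by
  have hw := continuousOn_waveNumber v
  have h1 := (differentiable_expQ a b).continuous.comp_continuousOn hw
  have h2 := (differentiable_expE a).continuous.comp_continuousOn hw
  have h3 := (differentiable_expE b).continuous.comp_continuousOn hw
  exact (((continuousOn_const.mul continuousOn_id).div_const 2).mul h1).add
    ((continuousOn_const.mul (continuousOn_id.div (continuousOn_id.add hw)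
    fun z _ => add_waveNumber_ne_zero hv z)).mul (h2.mul h3))

theorem differentiableOn_rightResolvent :
    DifferentiableOn ℂ (rightResolvent v a b) openQuadrant := by
  have hw := differentiableOn_waveNumber v
  have h1 := (differentiable_expQ a b).comp_differentiableOn hw
  have h2 := (differentiable_expE a).comp_differentiableOn hw
  have h3 := (differentiable_expE b).comp_differentiableOn hw
  exact ((((differentiableOn_const _).mul differentiableOn_id).div_const 2).mul h1).add
    (((differentiableOn_const _).mul (differentiableOn_id.div (differentiableOn_id.add hw)
    fun z _ => add_waveNumber_ne_zero hv z)).mul (h2.mul h3))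

theorem continuousOn_crossResolvent : ContinuousOn (crossResolvent v a b) closedQuadrant := by
  have hw := continuousOn_waveNumber v
  have h2 := (differentiable_expE a).continuous.continuousOn (s := closedQuadrant)
  have h3 := (differentiable_expE b).continuous.comp_continuousOn hw
  exact (continuousOn_const.mul (continuousOn_id.div (continuousOn_id.add hw)
    fun z _ => add_waveNumber_ne_zero hv z)).mul (h2.mul h3)

theorem differentiableOn_crossResolvent :
    DifferentiableOn ℂ (crossResolvent v a b) openQuadrant := by
  have hw := differentiableOn_waveNumber v
  have h2 := (differentiable_expE a).differentiableOn (s := openQuadrant)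
  have h3 := (differentiable_expE b).comp_differentiableOn hw
  exact ((differentiableOn_const _).mul (differentiableOn_id.div (differentiableOn_id.add hw)
    fun z _ => add_waveNumber_ne_zero hv z)).mul (h2.mul h3)

end Regularity

/-! ### Asymptotics of the integrated resolvent kernels at infinity. -/

section Decay

variable {v a b : ℝ} (hv : 0 < v) (ha : 0 ≤ a) (hb : 0 ≤ b) {k : ℂ} (hk : k ∈ closedQuadrant)
  (hkv : 2 * v ≤ ‖k‖)
include hv ha hb hk hkv

/-- The leading term of `expD` gives (i/2)(2i min(a, b)/k) = -min(a, b)/k. The reflected part is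
O(|k|⁻²), each `expE` being at most 2/|k|. -/
theorem norm_leftResolvent_add_le :
    ‖leftResolvent v a b k + (min a b : ℝ) / k‖ ≤ 4 / ‖k‖ ^ 2 := by
  have hkn : 0 < ‖k‖ := (by positivity : 0 < 2 * v).trans_le hkv
  have hk0 : k ≠ 0 := norm_pos_iff.1 hkn
  have h1 := norm_expD_sub_le hk.2 hk0 ha hb
  have hr : ‖(k - waveNumber v k) / (k + waveNumber v k)‖ ≤ 1 := by
    rw [norm_div]
    exact div_le_one_of_le₀ (norm_sub_le_norm_add_of_mem_closedQuadrant hk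
      (waveNumber_mem_closedQuadrant v hk)) (norm_nonneg _)
  have h2 : leftResolvent v a b k + (min a b : ℝ) / k = Complex.I / 2 *
      ((expD a b k - 2 * Complex.I * (min a b : ℝ) / k)
        + (k - waveNumber v k) / (k + waveNumber v k) * (expE a k * expE b k)) := by
    rw [leftResolvent]
    linear_combination ((min a b : ℝ) / k : ℂ) * Complex.I_sq
  have h3 : ‖(k - waveNumber v k) / (k + waveNumber v k) * (expE a k * expE b k)‖
      ≤ 1 * (2 / ‖k‖ * (2 / ‖k‖)) := by
    rw [norm_mul, norm_mul]
    exact mul_le_mul hr (mul_le_mul (norm_expE_le hk.2 hk0 ha) (norm_expE_le hk.2 hk0 hb)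
      (norm_nonneg _) (by positivity)) (by positivity) zero_le_one
  rw [h2, norm_mul, norm_div, Complex.norm_I, Complex.norm_ofNat]
  have h4 := (norm_add_le _ _).trans (add_le_add h1 h3)
  calc (1 : ℝ) / 2 * _ ≤ 1 / 2 * (4 / ‖k‖ ^ 2 + 1 * (2 / ‖k‖ * (2 / ‖k‖))) := by gcongr
    _ = 4 / ‖k‖ ^ 2 := by field_simp; norm_num

/-- Intervals on opposite sides of 0 do not overlap, so the coefficient of 1/k is 0; it is kept in
the form required by `integral_im_eq_of_quadrant`. -/
theorem norm_crossResolvent_le : ‖crossResolvent v a b k + (0 : ℝ) / k‖ ≤ 8 / ‖k‖ ^ 2 := by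
  have hkn : 0 < ‖k‖ := (by positivity : 0 < 2 * v).trans_le hkv
  have hk0 : k ≠ 0 := norm_pos_iff.1 hkn
  have hle := norm_le_two_mul_norm_waveNumber hv hkv
  have hwn : 0 < ‖waveNumber v k‖ := by linarith
  have hw0 : waveNumber v k ≠ 0 := norm_pos_iff.1 hwn
  have hw := waveNumber_mem_closedQuadrant v hk
  rw [Complex.ofReal_zero, zero_div, add_zero, crossResolvent, norm_mul, norm_mul, norm_mul,
    Complex.norm_I, one_mul]
  have h3 : 2 / ‖waveNumber v k‖ ≤ 4 / ‖k‖ := by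
    rw [div_le_div_iff₀ hwn hkn]; linarith
  calc _ ≤ 1 * (2 / ‖k‖ * (4 / ‖k‖)) :=
        mul_le_mul (norm_div_add_waveNumber_le_one hk) (mul_le_mul (norm_expE_le hk.2 hk0 ha)
          ((norm_expE_le hw.2 hw0 hb).trans h3) (norm_nonneg _) (by positivity)) (by positivity)
          zero_le_one
    _ = 8 / ‖k‖ ^ 2 := by field_simp; norm_num

theorem norm_rightResolvent_add_le :
    ‖rightResolvent v a b k + (min a b : ℝ) / k‖ ≤ (2 * min a b * v + 48) / ‖k‖ ^ 2 := by
  have hkn : 0 < ‖k‖ := (by positivity : 0 < 2 * v).trans_le hkv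
  have hk0 : k ≠ 0 := norm_pos_iff.1 hkn
  have hle := norm_le_two_mul_norm_waveNumber hv hkv
  have hwn : 0 < ‖waveNumber v k‖ := by linarith
  have hw0 : waveNumber v k ≠ 0 := norm_pos_iff.1 hwn
  have hw := waveNumber_mem_closedQuadrant v hk
  have hsq := waveNumber_sq v k
  have hm : 0 ≤ min a b := le_min ha hb
  set w := waveNumber v k with hwdef
  have hEE : ‖expE a w * expE b w‖ ≤ 4 / ‖w‖ ^ 2 := by
    rw [norm_mul]
    calc _ ≤ 2 / ‖w‖ * (2 / ‖w‖) := mul_le_mul (norm_expE_le hw.2 hw0 ha)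
          (norm_expE_le hw.2 hw0 hb) (norm_nonneg _) (by positivity)
      _ = 4 / ‖w‖ ^ 2 := by field_simp; norm_num
  have h1 : ‖expD a b w - 2 * Complex.I * (min a b : ℝ) / w - expE a w * expE b w‖
      ≤ 8 / ‖w‖ ^ 2 := by
    refine (norm_sub_le _ _).trans ?_
    have := add_le_add (norm_expD_sub_le hw.2 hw0 ha hb) hEE
    rw [← add_div] at this
    norm_num at this ⊢
    exact this
  -- The leading term is now -min(a, b)k/w²; it differs from -min(a, b)/k by min(a, b)v²/(kw²), the
  -- source of the constant 2 min(a, b)v. The other two terms contribute 32 and 16 through |w|⁻² ≤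
  -- 4|k|⁻².
  have h2 : rightResolvent v a b k + (min a b : ℝ) / k
      = -((min a b : ℝ) * v ^ 2 / (k * w ^ 2)) + k / (2 * w) * (Complex.I *
        (expD a b w - 2 * Complex.I * (min a b : ℝ) / w - expE a w * expE b w))
        + Complex.I * (k / (k + w)) * (expE a w * expE b w) := by
    rw [rightResolvent, ← hwdef, expQ_of_ne hw0]
    have hv2 : (v : ℂ) ^ 2 = k ^ 2 - w ^ 2 := by rw [hsq]; ring
    rw [hv2]
    have h3 : (min a b : ℝ) / k = -((min a b : ℝ) * (k ^ 2 - w ^ 2) / (k * w ^ 2))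
        - k / (2 * w) * (Complex.I * (2 * Complex.I * (min a b : ℝ) / w)) := by
      field_simp
      linear_combination ((min a b : ℝ) * (k : ℂ) ^ 2) * Complex.I_sq
    rw [h3]
    ring
  have hinv : 1 / ‖w‖ ≤ 2 / ‖k‖ := by
    rw [div_le_div_iff₀ hwn hkn]; linarith
  have hinv2 : 1 / ‖w‖ ^ 2 ≤ 4 / ‖k‖ ^ 2 := by
    rw [div_le_div_iff₀ (by positivity) (by positivity)]
    nlinarith
  have t1 : ‖-((min a b : ℝ) * (v : ℂ) ^ 2 / (k * w ^ 2))‖ ≤ 2 * min a b * v / ‖k‖ ^ 2 := by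
    rw [norm_neg, norm_div, norm_mul, norm_mul, norm_pow, norm_pow, Complex.norm_real,
      Complex.norm_real, Real.norm_eq_abs, Real.norm_eq_abs, sq_abs, abs_of_nonneg hm]
    calc min a b * v ^ 2 / (‖k‖ * ‖w‖ ^ 2) = min a b * v ^ 2 / ‖k‖ * (1 / ‖w‖ ^ 2) := by
          field_simp
      _ ≤ min a b * v ^ 2 / ‖k‖ * (4 / ‖k‖ ^ 2) := by gcongr
      _ = 2 * min a b * v / ‖k‖ ^ 2 * (2 * v / ‖k‖) := by field_simp; ring
      _ ≤ 2 * min a b * v / ‖k‖ ^ 2 * 1 := by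
          gcongr
          exact div_le_one_of_le₀ hkv hkn.le
      _ = _ := mul_one _
  have t2 : ‖k / (2 * w) * (Complex.I *
      (expD a b w - 2 * Complex.I * (min a b : ℝ) / w - expE a w * expE b w))‖
      ≤ 32 / ‖k‖ ^ 2 := by
    rw [norm_mul, norm_mul, Complex.norm_I, one_mul, norm_div, norm_mul, Complex.norm_ofNat]
    calc _ ≤ 1 * (8 / ‖w‖ ^ 2) := by
          refine mul_le_mul ?_ h1 (norm_nonneg _) zero_le_one
          exact div_le_one_of_le₀ hle (by positivity)
      _ = 8 * (1 / ‖w‖ ^ 2) := by ring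
      _ ≤ 8 * (4 / ‖k‖ ^ 2) := by gcongr
      _ = 32 / ‖k‖ ^ 2 := by ring
  have t3 : ‖Complex.I * (k / (k + w)) * (expE a w * expE b w)‖ ≤ 16 / ‖k‖ ^ 2 := by
    rw [norm_mul, norm_mul, Complex.norm_I, one_mul]
    calc _ ≤ 1 * (4 / ‖w‖ ^ 2) :=
          mul_le_mul (norm_div_add_waveNumber_le_one hk) hEE (norm_nonneg _) zero_le_one
      _ = 4 * (1 / ‖w‖ ^ 2) := by ring
      _ ≤ 4 * (4 / ‖k‖ ^ 2) := by gcongr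
      _ = 16 / ‖k‖ ^ 2 := by ring
  rw [h2]
  refine (norm_add₃_le).trans ((add_le_add (add_le_add t1 t2) t3).trans (le_of_eq ?_))
  ring

end Decay

/-! ### Purely imaginary values on the imaginary axis. -/

section ImaginaryAxis

variable {v : ℝ} (a b : ℝ) {y : ℝ} (hy : 0 < y)
include hy

theorem exists_div_add_waveNumber_mul_I :
    ∃ r : ℝ, (y * Complex.I) / (y * Complex.I + waveNumber v (y * Complex.I)) = r := by
  refine ⟨y / (y + √(y ^ 2 + v ^ 2)), ?_⟩
  rw [waveNumber_mul_I hy, ← add_mul, mul_div_mul_right _ _ Complex.I_ne_zero]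
  push_cast; rfl

theorem exists_waveNumber_mul_I : ∃ ω : ℝ, 0 < ω ∧ waveNumber v (y * Complex.I) = ω * Complex.I :=
  ⟨_, Real.sqrt_pos.2 (by positivity), waveNumber_mul_I hy⟩

/-- At negative k² both wave numbers are imaginary, so the exponentials and the reflection
coefficient are real and only the prefactor i/2 remains. -/
theorem re_leftResolvent_mul_I : (leftResolvent v a b (y * Complex.I)).re = 0 := by
  obtain ⟨ω, hω, hw⟩ := exists_waveNumber_mul_I (v := v) hy
  obtain ⟨d, hd⟩ := exists_expD_mul_I hy.ne' a b
  rw [leftResolvent, hd, expE_mul_I hy.ne', expE_mul_I hy.ne', hw, ← add_mul, ← sub_mul,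
    mul_div_mul_right _ _ Complex.I_ne_zero, ← Complex.ofReal_add, ← Complex.ofReal_sub,
    ← Complex.ofReal_div, ← Complex.ofReal_mul, ← Complex.ofReal_mul, ← Complex.ofReal_add,
    Complex.re_mul_ofReal]
  simp

theorem re_crossResolvent_mul_I : (crossResolvent v a b (y * Complex.I)).re = 0 := by
  obtain ⟨r, hr⟩ := exists_div_add_waveNumber_mul_I (v := v) hy
  obtain ⟨ω, hω, hw⟩ := exists_waveNumber_mul_I (v := v) hy
  rw [crossResolvent, hr, hw, expE_mul_I hy.ne', expE_mul_I hω.ne', ← Complex.ofReal_mul,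
    Complex.re_mul_ofReal]
  simp

theorem re_rightResolvent_mul_I : (rightResolvent v a b (y * Complex.I)).re = 0 := by
  obtain ⟨r, hr⟩ := exists_div_add_waveNumber_mul_I (v := v) hy
  obtain ⟨ω, hω, hw⟩ := exists_waveNumber_mul_I (v := v) hy
  obtain ⟨d, hd⟩ := exists_expD_mul_I hω.ne' a b
  have hω' : (ω : ℂ) ≠ 0 := by exact_mod_cast hω.ne'
  rw [rightResolvent, hr, hw, expQ_of_ne (mul_ne_zero hω' Complex.I_ne_zero), hd,
    expE_mul_I hω.ne', expE_mul_I hω.ne', ← Complex.ofReal_mul, ← Complex.ofReal_sub,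
    Complex.add_re, Complex.re_mul_ofReal]
  have h : ∀ q : ℝ, Complex.I * (y * Complex.I) / 2 * ((q : ℂ) / (ω * Complex.I))
      = Complex.I * ((y * q / (2 * ω) : ℝ) : ℂ) := by
    intro q
    push_cast
    have := Complex.I_ne_zero
    field_simp
  rw [h, Complex.re_mul_ofReal]
  simp

end ImaginaryAxis

/-! ### The three contour integrals. -/

section Integrals

variable {v a b : ℝ} (hv : 0 < v) (ha : 0 ≤ a) (hb : 0 ≤ b)
include hv ha hb

theorem integral_im_leftResolvent :
    IntegrableOn (fun k : ℝ => (leftResolvent v a b k).im) (Set.Ioi 0) ∧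
      ∫ k in Set.Ioi (0:ℝ), (leftResolvent v a b k).im = min a b * (Real.pi / 2) :=
  integral_im_eq_of_quadrant (continuousOn_leftResolvent hv a b)
    (differentiableOn_leftResolvent hv a b) (T₀ := 2 * v) (by positivity)
    (fun _ hz hT => norm_leftResolvent_add_le hv ha hb hz hT)
    fun _ hy => re_leftResolvent_mul_I a b hy

theorem integral_im_rightResolvent :
    IntegrableOn (fun k : ℝ => (rightResolvent v a b k).im) (Set.Ioi 0) ∧
      ∫ k in Set.Ioi (0:ℝ), (rightResolvent v a b k).im = min a b * (Real.pi / 2) :=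
  integral_im_eq_of_quadrant (continuousOn_rightResolvent hv a b)
    (differentiableOn_rightResolvent hv a b) (T₀ := 2 * v) (by positivity)
    (fun _ hz hT => norm_rightResolvent_add_le hv ha hb hz hT)
    fun _ hy => re_rightResolvent_mul_I a b hy

theorem integral_im_crossResolvent :
    IntegrableOn (fun k : ℝ => (crossResolvent v a b k).im) (Set.Ioi 0) ∧
      ∫ k in Set.Ioi (0:ℝ), (crossResolvent v a b k).im = 0 := by
  have h := integral_im_eq_of_quadrant (continuousOn_crossResolvent hv a b)
    (differentiableOn_crossResolvent hv a b) (T₀ := 2 * v) (by positivity)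
    (fun _ hz hT => norm_crossResolvent_le hv ha hb hz hT)
    fun _ hy => re_crossResolvent_mul_I a b hy
  rwa [zero_mul] at h

end Integrals

/-! ### The resolvent kernel on the real axis -/

section RealAxis

variable {v k : ℝ} (a b : ℝ)

theorem ofReal_div_add_mul_I {k α : ℝ} (h : 0 < k ^ 2 + α ^ 2) :
    (k : ℂ) / (k + α * Complex.I)
      = ((k ^ 2 / (k ^ 2 + α ^ 2) : ℝ) : ℂ) - ((k * α / (k ^ 2 + α ^ 2) : ℝ) : ℂ) * Complex.I := by
  have h0 : (k : ℂ) + α * Complex.I ≠ 0 := fun h0 => by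
    have h1 := congrArg Complex.re h0
    have h2 := congrArg Complex.im h0
    simp at h1 h2
    simp [h1, h2] at h
  have h1 : (k : ℂ) ^ 2 + α ^ 2 ≠ 0 := by exact_mod_cast h.ne'
  push_cast
  field_simp
  linear_combination (k : ℂ) * α ^ 2 * Complex.I_sq

theorem ofReal_sub_div_add_mul_I {k α : ℝ} (h : 0 < k ^ 2 + α ^ 2) :
    ((k : ℂ) - α * Complex.I) / (k + α * Complex.I)
      = (((k ^ 2 - α ^ 2) / (k ^ 2 + α ^ 2) : ℝ) : ℂ)
        - ((2 * k * α / (k ^ 2 + α ^ 2) : ℝ) : ℂ) * Complex.I := by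
  have h0 : (k : ℂ) + α * Complex.I ≠ 0 := fun h0 => by
    have h1 := congrArg Complex.re h0
    have h2 := congrArg Complex.im h0
    simp at h1 h2
    simp [h1, h2] at h
  have h1 : (k : ℂ) ^ 2 + α ^ 2 ≠ 0 := by exact_mod_cast h.ne'
  push_cast
  field_simp
  linear_combination (2 * (k : ℂ) * α ^ 2) * Complex.I_sq

/-- The direct wave contributes cc + ss and the reflected wave r(cc - ss), with r = (k - β)/(k + β).
The halves (1 ± r)/2 are k/(k + β) and β/(k + β), so the density is diagonal in the cosine and sine
states. -/
theorem im_leftResolvent_of_lt (hv : 0 < v) (hk : v < k) :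
    (leftResolvent v a b k).im = k / (k + √(k ^ 2 - v ^ 2)) * (cosInt k a * cosInt k b)
      + √(k ^ 2 - v ^ 2) / (k + √(k ^ 2 - v ^ 2)) * (sinInt k a * sinInt k b) := by
  have hk0 : 0 < k := hv.trans hk
  have hs : 0 ≤ √(k ^ 2 - v ^ 2) := Real.sqrt_nonneg _
  have hD := re_expD_ofReal hk0.ne' a b
  rw [leftResolvent, waveNumber_ofReal_of_lt hv hk, expE_ofReal hk0.ne', expE_ofReal hk0.ne']
  set β := √(k ^ 2 - v ^ 2)
  rw [← Complex.ofReal_sub, ← Complex.ofReal_add, ← Complex.ofReal_div]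
  have h2 : ∀ z : ℂ, (Complex.I / 2 * z).im = z.re / 2 := fun z => by simp; ring
  rw [h2, Complex.add_re, hD, Complex.re_ofReal_mul]
  simp only [Complex.mul_re, Complex.add_re, Complex.add_im, Complex.mul_im, Complex.ofReal_re,
    Complex.ofReal_im, Complex.I_re, Complex.I_im]
  have : k + β ≠ 0 := by positivity
  field_simp
  ring

/-- Below the step the reflection coefficient has modulus 1, so the density has rank one: a single
state per energy. -/
theorem im_leftResolvent_of_gt (hk0 : 0 < k) (hk : k < v) :
    (leftResolvent v a b k).im
      = (k * cosInt k a + √(v ^ 2 - k ^ 2) * sinInt k a)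
        * (k * cosInt k b + √(v ^ 2 - k ^ 2) * sinInt k b) / v ^ 2 := by
  have hv : 0 < v := hk0.trans hk
  have hD := re_expD_ofReal hk0.ne' a b
  have hsq : √(v ^ 2 - k ^ 2) ^ 2 = v ^ 2 - k ^ 2 := Real.sq_sqrt (by nlinarith)
  rw [leftResolvent, waveNumber_ofReal_of_gt hk0 hk, expE_ofReal hk0.ne', expE_ofReal hk0.ne']
  set α := √(v ^ 2 - k ^ 2)
  have hv2 : k ^ 2 + α ^ 2 = v ^ 2 := by rw [hsq]; ring
  rw [ofReal_sub_div_add_mul_I (by rw [hv2]; positivity), hv2]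
  have h2 : ∀ z : ℂ, (Complex.I / 2 * z).im = z.re / 2 := fun z => by simp; ring
  rw [h2, Complex.add_re, hD]
  simp only [Complex.mul_re, Complex.add_re, Complex.add_im, Complex.mul_im, Complex.ofReal_re,
    Complex.ofReal_im, Complex.I_re, Complex.I_im, Complex.sub_re, Complex.sub_im]
  field_simp
  rw [← hv2]
  ring

theorem im_rightResolvent_of_lt (hv : 0 < v) (hk : v < k) :
    (rightResolvent v a b k).im
      = k / (k + √(k ^ 2 - v ^ 2)) * (cosInt √(k ^ 2 - v ^ 2) a * cosInt √(k ^ 2 - v ^ 2) b)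
      + k ^ 2 / (√(k ^ 2 - v ^ 2) * (k + √(k ^ 2 - v ^ 2)))
        * (sinInt √(k ^ 2 - v ^ 2) a * sinInt √(k ^ 2 - v ^ 2) b) := by
  have hk0 : 0 < k := hv.trans hk
  have hs : 0 < √(k ^ 2 - v ^ 2) := Real.sqrt_pos.2 (by nlinarith)
  rw [rightResolvent, waveNumber_ofReal_of_lt hv hk]
  set β := √(k ^ 2 - v ^ 2)
  have hβ : (β : ℂ) ≠ 0 := by exact_mod_cast hs.ne'
  have hD := re_expD_ofReal hs.ne' a b
  rw [expQ_of_ne hβ, expE_ofReal hs.ne', expE_ofReal hs.ne', ← Complex.ofReal_add,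
    ← Complex.ofReal_div]
  have h2 : ∀ z : ℂ, (Complex.I * k / 2 * (z / β)).im = k / (2 * β) * z.re := fun z => by
    have : Complex.I * k / 2 * (z / β) = ((k / (2 * β) : ℝ) : ℂ) * (Complex.I * z) := by
      push_cast; field_simp
    rw [this, Complex.im_ofReal_mul, Complex.I_mul_im]
  have h3 : ∀ (r : ℝ) (z : ℂ), (Complex.I * r * z).im = r * z.re := fun r z => by
    rw [mul_comm Complex.I, mul_assoc, Complex.im_ofReal_mul, Complex.I_mul_im]
  rw [Complex.add_im, h2, h3, Complex.sub_re, hD]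
  simp only [Complex.mul_re, Complex.add_re, Complex.add_im, Complex.mul_im, Complex.ofReal_re,
    Complex.ofReal_im, Complex.I_re, Complex.I_im]
  have : k + β ≠ 0 := by positivity
  field_simp
  ring

/-- Here the wave number is iα, so the `expQ` term is real and drops out. Only the imaginary part of
ik/(k + iα), equal to k²/v², survives. -/
theorem im_rightResolvent_of_gt (hk0 : 0 < k) (hk : k < v) :
    (rightResolvent v a b k).im
      = k ^ 2 / v ^ 2 * (decayInt √(v ^ 2 - k ^ 2) a * decayInt √(v ^ 2 - k ^ 2) b) := by
  have hs : 0 < √(v ^ 2 - k ^ 2) := Real.sqrt_pos.2 (by nlinarith)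
  have hsq : √(v ^ 2 - k ^ 2) ^ 2 = v ^ 2 - k ^ 2 := Real.sq_sqrt (by nlinarith)
  rw [rightResolvent, waveNumber_ofReal_of_gt hk0 hk]
  set α := √(v ^ 2 - k ^ 2)
  have hα : (α : ℂ) ≠ 0 := by exact_mod_cast hs.ne'
  obtain ⟨d, hd⟩ := exists_expD_mul_I hs.ne' a b
  have hv2 : k ^ 2 + α ^ 2 = v ^ 2 := by rw [hsq]; ring
  rw [expQ_of_ne (mul_ne_zero hα Complex.I_ne_zero), hd, expE_mul_I hs.ne', expE_mul_I hs.ne',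
    ofReal_div_add_mul_I (by rw [hv2]; nlinarith), hv2, ← Complex.ofReal_mul, ← Complex.ofReal_sub]
  have h : ∀ q : ℝ, Complex.I * k / 2 * ((q : ℂ) / (α * Complex.I))
      = ((k * q / (2 * α) : ℝ) : ℂ) := by
    intro q
    push_cast
    have := Complex.I_ne_zero
    field_simp
  rw [h, Complex.add_im, Complex.ofReal_im, Complex.im_mul_ofReal, Complex.I_mul_im, decayInt,
    decayInt]
  simp only [Complex.mul_re, Complex.sub_re, Complex.ofReal_re, Complex.ofReal_im, Complex.I_re,
    Complex.I_im]
  ring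

theorem im_crossResolvent_of_lt (hv : 0 < v) (hk : v < k) :
    (crossResolvent v a b k).im
      = k / (k + √(k ^ 2 - v ^ 2)) * (cosInt k a * cosInt √(k ^ 2 - v ^ 2) b
        - sinInt k a * sinInt √(k ^ 2 - v ^ 2) b) := by
  have hk0 : 0 < k := hv.trans hk
  have hs : 0 < √(k ^ 2 - v ^ 2) := Real.sqrt_pos.2 (by nlinarith)
  rw [crossResolvent, waveNumber_ofReal_of_lt hv hk]
  set β := √(k ^ 2 - v ^ 2)
  rw [expE_ofReal hs.ne', expE_ofReal hk0.ne', ← Complex.ofReal_add, ← Complex.ofReal_div]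
  have h3 : ∀ (r : ℝ) (z : ℂ), (Complex.I * r * z).im = r * z.re := fun r z => by
    rw [mul_comm Complex.I, mul_assoc, Complex.im_ofReal_mul, Complex.I_mul_im]
  rw [h3]
  simp

theorem im_crossResolvent_of_gt (hk0 : 0 < k) (hk : k < v) :
    (crossResolvent v a b k).im
      = k / v ^ 2 * ((k * cosInt k a + √(v ^ 2 - k ^ 2) * sinInt k a)
        * decayInt √(v ^ 2 - k ^ 2) b) := by
  have hs : 0 < √(v ^ 2 - k ^ 2) := Real.sqrt_pos.2 (by nlinarith)
  have hsq : √(v ^ 2 - k ^ 2) ^ 2 = v ^ 2 - k ^ 2 := Real.sq_sqrt (by nlinarith)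
  rw [crossResolvent, waveNumber_ofReal_of_gt hk0 hk]
  set α := √(v ^ 2 - k ^ 2)
  have hv2 : k ^ 2 + α ^ 2 = v ^ 2 := by rw [hsq]; ring
  rw [expE_mul_I hs.ne', ofReal_div_add_mul_I (by rw [hv2]; nlinarith), hv2,
    expE_ofReal hk0.ne', ← decayInt]
  simp only [Complex.mul_im, Complex.mul_re, Complex.sub_re, Complex.sub_im, Complex.add_re,
    Complex.add_im, Complex.ofReal_re, Complex.ofReal_im, Complex.I_re, Complex.I_im]
  ring

end RealAxis

/-! ### The spectral measures -/

/-- The absolute value of the derivative of the spectral function, in closed form. -/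
noncomputable def stepWeight (V₀ : ℝ) : Fin 3 → ℝ → ℝ
  | 0 => fun _ => 1
  | 1 => fun k => 2 * k / (stepBeta V₀ k + k)
  | 2 => fun k => (stepBeta V₀ k ^ 2 + k ^ 2) / (stepBeta V₀ k * (stepBeta V₀ k + k))

section Spectral

variable {V₀ : ℝ} (hV₀ : 0 < V₀)
include hV₀

theorem sqrt_two_mul_pos : 0 < √(2 * V₀) := Real.sqrt_pos.2 (by positivity)

theorem sqrt_two_mul_sq : √(2 * V₀) ^ 2 = 2 * V₀ := Real.sq_sqrt (by positivity)

theorem stepBeta_eq (k : ℝ) : stepBeta V₀ k = √(k ^ 2 - √(2 * V₀) ^ 2) := by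
  rw [sqrt_two_mul_sq hV₀, stepBeta]

theorem stepAlpha_eq (k : ℝ) : stepAlpha V₀ k = √(√(2 * V₀) ^ 2 - k ^ 2) := by
  rw [sqrt_two_mul_sq hV₀, stepAlpha]

theorem sq_sub_pos_of_lt {k : ℝ} (hk : √(2 * V₀) < k) : 0 < k ^ 2 - 2 * V₀ := by
  have h1 := sqrt_two_mul_pos hV₀
  have h2 := sqrt_two_mul_sq hV₀
  nlinarith

theorem stepBeta_pos {k : ℝ} (hk : √(2 * V₀) < k) : 0 < stepBeta V₀ k :=
  Real.sqrt_pos.2 (sq_sub_pos_of_lt hV₀ hk)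

theorem stepAlpha_pos {k : ℝ} (hk0 : 0 < k) (hk : k < √(2 * V₀)) : 0 < stepAlpha V₀ k := by
  refine Real.sqrt_pos.2 ?_
  have h2 := sqrt_two_mul_sq hV₀
  nlinarith

theorem stepBeta_sq {k : ℝ} (hk : √(2 * V₀) < k) : stepBeta V₀ k ^ 2 = k ^ 2 - 2 * V₀ :=
  Real.sq_sqrt (sq_sub_pos_of_lt hV₀ hk).le

theorem stepAlpha_sq {k : ℝ} (hk0 : 0 < k) (hk : k < √(2 * V₀)) :
    stepAlpha V₀ k ^ 2 = 2 * V₀ - k ^ 2 := by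
  refine Real.sq_sqrt ?_
  have h2 := sqrt_two_mul_sq hV₀
  nlinarith

theorem hasDerivAt_stepBeta {k : ℝ} (hk : √(2 * V₀) < k) :
    HasDerivAt (stepBeta V₀) (k / stepBeta V₀ k) k := by
  have h1 : HasDerivAt (fun k : ℝ => k ^ 2 - 2 * V₀) (2 * k) k := by
    simpa using (hasDerivAt_pow 2 k).sub_const (2 * V₀)
  have h2 := h1.sqrt (sq_sub_pos_of_lt hV₀ hk).ne'
  have h3 : 2 * k / (2 * √(k ^ 2 - 2 * V₀)) = k / stepBeta V₀ k := by
    rw [stepBeta, mul_div_mul_left _ _ two_ne_zero]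
  rw [h3] at h2
  exact h2

theorem hasDerivAt_stepSpectral_one {k : ℝ} (hk : √(2 * V₀) < k) :
    HasDerivAt (stepSpectral V₀ 1) (stepWeight V₀ 1 k) k := by
  have hβ := stepBeta_pos hV₀ hk
  have hk0 := (sqrt_two_mul_pos hV₀).trans hk
  have hd := hasDerivAt_stepBeta hV₀ hk
  have hs := hd.add (hasDerivAt_id k)
  have h := ((((hs.pow 2).add ((hd.pow 2).add ((hasDerivAt_id k).pow 2))).div
    (hs.const_mul 3) (by simp; positivity))).add_const (√(2 * V₀) / 3)
  refine h.congr_deriv ?_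
  simp only [stepWeight, Pi.add_apply, Pi.pow_apply, id]
  have : stepBeta V₀ k + k ≠ 0 := by positivity
  field_simp
  ring

/-- With β' = k/β the sum β + k has derivative (β + k)/β, which collapses the quotient. κ₂ is
decreasing, hence the sign. -/
theorem hasDerivAt_stepSpectral_two {k : ℝ} (hk : √(2 * V₀) < k) :
    HasDerivAt (stepSpectral V₀ 2) (-stepWeight V₀ 2 k) k := by
  have hβ := stepBeta_pos hV₀ hk
  have hk0 := (sqrt_two_mul_pos hV₀).trans hk
  have hd := hasDerivAt_stepBeta hV₀ hk
  have hs := hd.add (hasDerivAt_id k)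
  have h := ((((hs.pow 2).add ((hd.const_mul 2).mul (hasDerivAt_id k))).div
    (hs.const_mul 3) (by simp; positivity))).neg.add_const (√(2 * V₀) / 3)
  refine h.congr_deriv ?_
  simp only [stepWeight, Pi.add_apply, Pi.pow_apply, Pi.mul_apply, id]
  have : stepBeta V₀ k + k ≠ 0 := by positivity
  field_simp
  ring

theorem hasDerivAt_stepSpectral (i : Fin 3) {k : ℝ} (hk : k ∈ stepRange V₀ i) :
    ∃ d, HasDerivAt (stepSpectral V₀ i) d k ∧ |d| = stepWeight V₀ i k := by
  fin_cases i
  · exact ⟨1, hasDerivAt_id k, abs_one⟩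
  · have hβ := stepBeta_pos hV₀ hk
    have hk0 := (sqrt_two_mul_pos hV₀).trans hk
    exact ⟨_, hasDerivAt_stepSpectral_one hV₀ hk, abs_of_nonneg (by
      simp only [stepWeight]; positivity)⟩
  · have hβ := stepBeta_pos hV₀ hk
    have hk0 := (sqrt_two_mul_pos hV₀).trans hk
    exact ⟨_, hasDerivAt_stepSpectral_two hV₀ hk, by
      rw [abs_neg]; exact abs_of_nonneg (by simp only [stepWeight]; positivity)⟩

theorem stepWeight_nonneg (i : Fin 3) {k : ℝ} (hk : k ∈ stepRange V₀ i) :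
    0 ≤ stepWeight V₀ i k := by
  obtain ⟨d, -, hd⟩ := hasDerivAt_stepSpectral hV₀ i hk
  rw [← hd]; exact abs_nonneg d

omit hV₀ in
theorem measurable_stepBeta : Measurable (stepBeta V₀) := by
  unfold stepBeta; fun_prop

omit hV₀ in
theorem measurable_stepAlpha : Measurable (stepAlpha V₀) := by
  unfold stepAlpha; fun_prop

omit hV₀ in
theorem measurable_stepWeight (i : Fin 3) : Measurable (stepWeight V₀ i) := by
  have := measurable_stepBeta (V₀ := V₀)
  fin_cases i
  · exact measurable_const
  · change Measurable fun k => 2 * k / (stepBeta V₀ k + k)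
    fun_prop
  · change Measurable fun k =>
      (stepBeta V₀ k ^ 2 + k ^ 2) / (stepBeta V₀ k * (stepBeta V₀ k + k))
    fun_prop

omit hV₀ in
theorem measurableSet_stepRange (i : Fin 3) : MeasurableSet (stepRange V₀ i) := by
  fin_cases i
  exacts [measurableSet_Ioo, measurableSet_Ioi, measurableSet_Ioi]

theorem stepMeasure_eq (i : Fin 3) : stepMeasure V₀ i =
    (volume.restrict (stepRange V₀ i)).withDensity
      fun k => ENNReal.ofReal (stepWeight V₀ i k) := by
  refine withDensity_congr_ae ?_
  filter_upwards [ae_restrict_mem (measurableSet_stepRange i)] with k hk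
  obtain ⟨d, hd, hd'⟩ := hasDerivAt_stepSpectral hV₀ i hk
  rw [hd.deriv, hd']

omit hV₀ in
theorem sigmaFinite_stepMeasure (i : Fin 3) : SigmaFinite (stepMeasure V₀ i) :=
  SigmaFinite.withDensity fun k => Real.toNNReal |deriv (stepSpectral V₀ i) k|

theorem integral_stepMeasure (i : Fin 3) (g : ℝ → ℂ) :
    ∫ k, g k ∂(stepMeasure V₀ i) = ∫ k in stepRange V₀ i, (stepWeight V₀ i k : ℂ) * g k := by
  rw [stepMeasure_eq hV₀, integral_withDensity_eq_integral_toReal_smul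
    (measurable_stepWeight i).ennreal_ofReal (by simp)]
  refine setIntegral_congr_fun (measurableSet_stepRange i) fun k hk => ?_
  simp only [ENNReal.toReal_ofReal (stepWeight_nonneg hV₀ i hk), Complex.real_smul]

theorem integrable_stepMeasure_iff {E : Type*} [NormedAddCommGroup E] [NormedSpace ℝ E]
    (i : Fin 3) {g : ℝ → E} : Integrable g (stepMeasure V₀ i) ↔
      IntegrableOn (fun k => stepWeight V₀ i k • g k) (stepRange V₀ i) := by
  rw [stepMeasure_eq hV₀, integrable_withDensity_iff_integrable_smul'
    (measurable_stepWeight i).ennreal_ofReal (by simp)]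
  refine integrable_congr ?_
  filter_upwards [ae_restrict_mem (measurableSet_stepRange i)] with k hk
  simp only [ENNReal.toReal_ofReal (stepWeight_nonneg hV₀ i hk)]

omit hV₀ in
theorem ae_stepMeasure_mem (i : Fin 3) : ∀ᵐ k ∂(stepMeasure V₀ i), k ∈ stepRange V₀ i :=
  (withDensity_absolutelyContinuous _ _).ae_le (ae_restrict_mem (measurableSet_stepRange i))

theorem continuousOn_stepSpectral (i : Fin 3) :
    ContinuousOn (stepSpectral V₀ i) (Set.Ici √(2 * V₀)) := by
  have hβ : Continuous (stepBeta V₀) := by unfold stepBeta; fun_prop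
  have h0 : ∀ k ∈ Set.Ici √(2 * V₀), 3 * (stepBeta V₀ k + k) ≠ 0 := fun k hk => by
    have h1 : 0 < k := (sqrt_two_mul_pos hV₀).trans_le hk
    have h2 : 0 ≤ stepBeta V₀ k := Real.sqrt_nonneg _
    positivity
  fin_cases i
  · exact continuousOn_id
  · exact (ContinuousOn.div (by fun_prop) (by fun_prop) h0).add continuousOn_const
  · exact (ContinuousOn.div (by fun_prop) (by fun_prop) h0).neg.add continuousOn_const

/-- The third weight blows up like 1/β at the threshold. It is integrable there because, up to sign,
it is a derivative of constant sign of a function continuous up to the endpoint. -/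
theorem integrableOn_stepWeight (i : Fin 3) (K : ℝ) :
    IntegrableOn (stepWeight V₀ i) (stepRange V₀ i ∩ Set.Iic K) := by
  have hv := sqrt_two_mul_pos hV₀
  fin_cases i
  · exact (integrableOn_const (measure_Ioo_lt_top.ne)).mono_set Set.inter_subset_left
  · change IntegrableOn (stepWeight V₀ 1) (Set.Ioi _ ∩ Set.Iic K)
    rw [Set.Ioi_inter_Iic]
    exact intervalIntegral.integrableOn_deriv_of_nonneg
      ((continuousOn_stepSpectral hV₀ 1).mono Set.Icc_subset_Ici_self)
      (fun k hk => hasDerivAt_stepSpectral_one hV₀ hk.1)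
      fun k hk => stepWeight_nonneg hV₀ 1 hk.1
  · change IntegrableOn (stepWeight V₀ 2) (Set.Ioi _ ∩ Set.Iic K)
    rw [Set.Ioi_inter_Iic]
    exact intervalIntegral.integrableOn_deriv_of_nonneg
      ((continuousOn_stepSpectral hV₀ 2).neg.mono Set.Icc_subset_Ici_self)
      (fun k hk => by simpa using (hasDerivAt_stepSpectral_two hV₀ hk.1).neg)
      fun k hk => stepWeight_nonneg hV₀ 2 hk.1

theorem stepMeasure_Iic_ne_top (i : Fin 3) (K : ℝ) : stepMeasure V₀ i (Set.Iic K) ≠ ⊤ := by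
  rw [stepMeasure_eq hV₀, withDensity_apply _ measurableSet_Iic,
    Measure.restrict_restrict measurableSet_Iic, Set.inter_comm]
  exact (integrableOn_stepWeight hV₀ i K).lintegral_lt_top.ne

/-! ### Regularity and boundedness of the states -/

omit hV₀ in
theorem measurable_stepState (i : Fin 3) : Measurable (Function.uncurry (stepState V₀ i)) := by
  have hβ : Measurable fun z : ℝ × ℝ => stepBeta V₀ z.1 := measurable_stepBeta.comp measurable_fst
  have hα : Measurable fun z : ℝ × ℝ => stepAlpha V₀ z.1 := measurable_stepAlpha.comp measurable_fst
  have hs : MeasurableSet {z : ℝ × ℝ | z.2 ≤ 0} := measurableSet_le measurable_snd measurable_const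
  fin_cases i
  · refine Complex.measurable_ofReal.comp (Measurable.ite hs ?_ ?_) <;> fun_prop
  · refine Complex.measurable_ofReal.comp (Measurable.ite hs ?_ ?_) <;> fun_prop
  · refine Complex.measurable_ofReal.comp (Measurable.ite hs ?_ ?_) <;> fun_prop

omit hV₀ in
theorem sqrt_two_mul_div_pi_le_one {p q : ℝ} (hp : 0 ≤ p) (hpq : p ≤ q) :
    √(2 * p / (Real.pi * q)) ≤ 1 := by
  rw [Real.sqrt_le_one]
  refine div_le_one_of_le₀ ?_ (mul_nonneg Real.pi_pos.le (hp.trans hpq))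
  nlinarith [Real.pi_gt_three, mul_nonneg (by linarith [Real.pi_gt_three] : 0 ≤ Real.pi - 2) hp,
    mul_le_mul_of_nonneg_left hpq Real.pi_pos.le]

omit hV₀ in
-- The bound holds for every real `k`, also outside the range of the family, as the superposition
-- lemmas require. The value 2 comes from the two terms of the evanescent state on the left.
theorem norm_stepState_le (i : Fin 3) (k x : ℝ) : ‖stepState V₀ i k x‖ ≤ 2 := by
  have hα := sq_nonneg (stepAlpha V₀ k)
  have hβ := sq_nonneg (stepBeta V₀ k)
  have hk := sq_nonneg k
  have hmul : ∀ {s c : ℝ}, 0 ≤ s → s ≤ 1 → |c| ≤ 1 → |s * c| ≤ 1 := fun hs0 hs hc => by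
    rw [abs_mul, abs_of_nonneg hs0]
    exact mul_le_one₀ hs (abs_nonneg _) hc
  have hπ : 1 / √Real.pi ≤ 1 := by
    rw [div_le_one (Real.sqrt_pos.2 Real.pi_pos), Real.one_le_sqrt]
    linarith [Real.pi_gt_three]
  have hπ0 : 0 ≤ 1 / √Real.pi := by positivity
  fin_cases i
  · change ‖((evanescentState V₀ k x : ℝ) : ℂ)‖ ≤ 2
    rw [Complex.norm_real, Real.norm_eq_abs, evanescentState]
    have h1 := sqrt_two_mul_div_pi_le_one hk (le_add_of_nonneg_left hα)
    have h2 := sqrt_two_mul_div_pi_le_one hα (le_add_of_nonneg_right hk)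
    split_ifs with h
    · refine (abs_sub _ _).trans ?_
      have a1 := hmul (Real.sqrt_nonneg _) h1 (Real.abs_cos_le_one (k * x))
      have a2 := hmul (Real.sqrt_nonneg _) h2 (Real.abs_sin_le_one (k * x))
      linarith
    · have h3 : |Real.exp (-(stepAlpha V₀ k * x))| ≤ 1 := by
        rw [Real.abs_exp, Real.exp_le_one_iff]
        exact neg_nonpos.2 (mul_nonneg (Real.sqrt_nonneg _) (not_le.1 h).le)
      linarith [hmul (Real.sqrt_nonneg _) h1 h3]
  · change ‖((cosineState V₀ k x : ℝ) : ℂ)‖ ≤ 2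
    rw [Complex.norm_real, Real.norm_eq_abs, cosineState]
    split_ifs with h
    · linarith [hmul hπ0 hπ (Real.abs_cos_le_one (k * x))]
    · linarith [hmul hπ0 hπ (Real.abs_cos_le_one (stepBeta V₀ k * x))]
  · change ‖((sineState V₀ k x : ℝ) : ℂ)‖ ≤ 2
    rw [Complex.norm_real, Real.norm_eq_abs, sineState]
    split_ifs with h
    · linarith [hmul (Real.sqrt_nonneg _) (sqrt_two_mul_div_pi_le_one hβ (le_add_of_nonneg_right hk))
        (Real.abs_sin_le_one (k * x))]
    · linarith [hmul (Real.sqrt_nonneg _) (sqrt_two_mul_div_pi_le_one hk (le_add_of_nonneg_left hβ))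
        (Real.abs_sin_le_one (stepBeta V₀ k * x))]

end Spectral

/-! ### Amplitudes of intervals -/

theorem integral_cos_mul {k : ℝ} (hk : k ≠ 0) (a b : ℝ) :
    ∫ x in a..b, Real.cos (k * x) = (Real.sin (k * b) - Real.sin (k * a)) / k := by
  rw [intervalIntegral.integral_comp_mul_left Real.cos hk, integral_cos, smul_eq_mul]
  field_simp

theorem integral_sin_mul {k : ℝ} (hk : k ≠ 0) (a b : ℝ) :
    ∫ x in a..b, Real.sin (k * x) = (Real.cos (k * a) - Real.cos (k * b)) / k := by
  rw [intervalIntegral.integral_comp_mul_left Real.sin hk, integral_sin, smul_eq_mul]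
  field_simp

theorem integral_exp_neg_mul {α : ℝ} (hα : α ≠ 0) (a : ℝ) :
    ∫ x in (0:ℝ)..a, Real.exp (-(α * x)) = decayInt α a := by
  have h := intervalIntegral.integral_comp_mul_left (a := 0) (b := a) Real.exp (neg_ne_zero.2 hα)
  simp only [neg_mul] at h
  rw [h, integral_exp, smul_eq_mul, decayInt]
  simp only [mul_zero, neg_zero, Real.exp_zero]
  field_simp
  ring

theorem amplitude_uIoc_of_nonneg {ψ : ℝ → ℝ → ℂ} {g : ℝ → ℝ} {k b : ℝ} (hb : 0 ≤ b)
    (h : ∀ x, 0 < x → ψ k x = g x) :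
    amplitude ψ ((Ι 0 b).indicator 1) k = ((∫ x in (0:ℝ)..b, g x : ℝ) : ℂ) := by
  rw [amplitude_indicator_one, Set.uIoc_of_le hb, intervalIntegral.integral_of_le hb,
    ← Complex.conj_ofReal, ← integral_complex_ofReal]
  congr 1
  exact setIntegral_congr_fun measurableSet_Ioc fun x hx => h x hx.1

theorem amplitude_uIoc_of_nonpos {ψ : ℝ → ℝ → ℂ} {g : ℝ → ℝ} {k a : ℝ} (ha : 0 ≤ a)
    (h : ∀ x, x ≤ 0 → ψ k x = g x) :
    amplitude ψ ((Ι 0 (-a)).indicator 1) k = ((∫ x in -a..0, g x : ℝ) : ℂ) := by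
  rw [amplitude_indicator_one, Set.uIoc_of_ge (neg_nonpos.2 ha),
    intervalIntegral.integral_of_le (neg_nonpos.2 ha), ← Complex.conj_ofReal,
    ← integral_complex_ofReal]
  congr 1
  exact setIntegral_congr_fun measurableSet_Ioc fun x hx => h x hx.2

section Amplitudes

variable {V₀ k : ℝ}

theorem amplitude_zero_left (hk : k ≠ 0) {a : ℝ} (ha : 0 ≤ a) :
    amplitude (stepState V₀ 0) ((Ι 0 (-a)).indicator 1) k =
      ((√(2 * k ^ 2 / (Real.pi * (stepAlpha V₀ k ^ 2 + k ^ 2))) * cosInt k a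
        + √(2 * stepAlpha V₀ k ^ 2 / (Real.pi * (stepAlpha V₀ k ^ 2 + k ^ 2))) * sinInt k a : ℝ)
        : ℂ) := by
  rw [amplitude_uIoc_of_nonpos ha fun x hx =>
    congrArg Complex.ofReal (by rw [evanescentState, if_pos hx])]
  congr 1
  rw [intervalIntegral.integral_sub (Continuous.intervalIntegrable (by fun_prop) _ _)
    (Continuous.intervalIntegrable (by fun_prop) _ _), intervalIntegral.integral_const_mul,
    intervalIntegral.integral_const_mul, integral_cos_mul hk, integral_sin_mul hk, cosInt, sinInt]
  simp only [mul_neg, Real.sin_neg, Real.cos_neg, mul_zero, Real.sin_zero, Real.cos_zero]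
  ring

theorem amplitude_one_left (hk : k ≠ 0) {a : ℝ} (ha : 0 ≤ a) :
    amplitude (stepState V₀ 1) ((Ι 0 (-a)).indicator 1) k =
      ((1 / √Real.pi * cosInt k a : ℝ) : ℂ) := by
  rw [amplitude_uIoc_of_nonpos ha fun x hx =>
    congrArg Complex.ofReal (by rw [cosineState, if_pos hx])]
  congr 1
  rw [intervalIntegral.integral_const_mul, integral_cos_mul hk, cosInt]
  simp

theorem amplitude_two_left (hk : k ≠ 0) {a : ℝ} (ha : 0 ≤ a) :
    amplitude (stepState V₀ 2) ((Ι 0 (-a)).indicator 1) k =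
      ((-(√(2 * stepBeta V₀ k ^ 2 / (Real.pi * (stepBeta V₀ k ^ 2 + k ^ 2))) * sinInt k a) : ℝ)
        : ℂ) := by
  rw [amplitude_uIoc_of_nonpos ha fun x hx =>
    congrArg Complex.ofReal (by rw [sineState, if_pos hx])]
  congr 1
  rw [intervalIntegral.integral_const_mul, integral_sin_mul hk, sinInt]
  simp only [mul_neg, Real.cos_neg, mul_zero, Real.cos_zero]
  ring

theorem amplitude_zero_right (hα : stepAlpha V₀ k ≠ 0) {b : ℝ} (hb : 0 ≤ b) :
    amplitude (stepState V₀ 0) ((Ι 0 b).indicator 1) k =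
      ((√(2 * k ^ 2 / (Real.pi * (stepAlpha V₀ k ^ 2 + k ^ 2)))
        * decayInt (stepAlpha V₀ k) b : ℝ) : ℂ) := by
  rw [amplitude_uIoc_of_nonneg hb fun x hx =>
    congrArg Complex.ofReal (by rw [evanescentState, if_neg (not_le.2 hx)])]
  rw [intervalIntegral.integral_const_mul, integral_exp_neg_mul hα]

theorem amplitude_one_right (hβ : stepBeta V₀ k ≠ 0) {b : ℝ} (hb : 0 ≤ b) :
    amplitude (stepState V₀ 1) ((Ι 0 b).indicator 1) k =
      ((1 / √Real.pi * cosInt (stepBeta V₀ k) b : ℝ) : ℂ) := by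
  rw [amplitude_uIoc_of_nonneg hb fun x hx =>
    congrArg Complex.ofReal (by rw [cosineState, if_neg (not_le.2 hx)])]
  congr 1
  rw [intervalIntegral.integral_const_mul, integral_cos_mul hβ, cosInt]
  simp

theorem amplitude_two_right (hβ : stepBeta V₀ k ≠ 0) {b : ℝ} (hb : 0 ≤ b) :
    amplitude (stepState V₀ 2) ((Ι 0 b).indicator 1) k =
      ((√(2 * k ^ 2 / (Real.pi * (stepBeta V₀ k ^ 2 + k ^ 2)))
        * sinInt (stepBeta V₀ k) b : ℝ) : ℂ) := by
  rw [amplitude_uIoc_of_nonneg hb fun x hx =>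
    congrArg Complex.ofReal (by rw [sineState, if_neg (not_le.2 hx)])]
  congr 1
  rw [intervalIntegral.integral_const_mul, integral_sin_mul hβ, sinInt]
  simp

end Amplitudes

theorem sqrt_two_mul_sq_div {x q : ℝ} (hx : 0 ≤ x) :
    √(2 * x ^ 2 / (Real.pi * q)) = x * √(2 / (Real.pi * q)) := by
  rw [mul_comm 2, mul_div_assoc, Real.sqrt_mul (sq_nonneg x), Real.sqrt_sq hx]

theorem one_div_sqrt_pi_sq : 1 / √Real.pi * (1 / √Real.pi) = 1 / Real.pi := by
  rw [div_mul_div_comm, one_mul, Real.mul_self_sqrt Real.pi_pos.le]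

/-- `J` is the density in `k` of the sesquilinear form of the intervals from `0` to `a` and from
`0` to `b`. -/
structure IsIntervalDensity (V₀ a b : ℝ) (J : ℝ → ℝ) : Prop where
  integrableOn : IntegrableOn J (Set.Ioi 0)
  integral_eq : ∫ k in Set.Ioi (0:ℝ), J k = volume.real (Ι 0 a ∩ Ι 0 b)
  below : ∀ k ∈ stepRange V₀ 0, amplitude (stepState V₀ 0) ((Ι 0 b).indicator 1) k
    * amplitude (stepState V₀ 0) ((Ι 0 a).indicator 1) k = J k
  above : ∀ k ∈ stepRange V₀ 1,
    stepWeight V₀ 1 k * (amplitude (stepState V₀ 1) ((Ι 0 b).indicator 1) k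
      * amplitude (stepState V₀ 1) ((Ι 0 a).indicator 1) k)
    + stepWeight V₀ 2 k * (amplitude (stepState V₀ 2) ((Ι 0 b).indicator 1) k
      * amplitude (stepState V₀ 2) ((Ι 0 a).indicator 1) k) = J k

theorem IsIntervalDensity.symm {V₀ a b : ℝ} {J : ℝ → ℝ} (h : IsIntervalDensity V₀ a b J) :
    IsIntervalDensity V₀ b a J where
  integrableOn := h.integrableOn
  integral_eq := by rw [Set.inter_comm]; exact h.integral_eq
  below k hk := by rw [mul_comm]; exact h.below k hk
  above k hk := by rw [← h.above k hk]; ring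

section Density

variable {V₀ : ℝ} (hV₀ : 0 < V₀) {a b : ℝ} (ha : 0 ≤ a) (hb : 0 ≤ b)
include hV₀ ha hb

/-- The weights and normalizations multiply out: (1/π)·2k/(β + k) for the cosine states, and for the
sine states the factor β² + k² cancels to leave (2/π)β/(β + k). These are the coefficients in
`im_leftResolvent_of_lt` times 2/π. -/
theorem isIntervalDensity_left : IsIntervalDensity V₀ (-a) (-b)
    fun k => 2 / Real.pi * (leftResolvent √(2 * V₀) a b k).im := by
  have hπ := Real.pi_pos
  have hv := sqrt_two_mul_pos hV₀
  obtain ⟨h1, h2⟩ := integral_im_leftResolvent hv ha hb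
  refine ⟨h1.const_mul _, ?_, fun k hk => ?_, fun k hk => ?_⟩
  · rw [integral_const_mul, h2, Set.uIoc_of_ge (neg_nonpos.2 ha), Set.uIoc_of_ge (neg_nonpos.2 hb),
      Set.Ioc_inter_Ioc, Real.volume_real_Ioc, inf_idem, max_neg_neg, zero_sub, neg_neg,
      max_eq_left (le_min ha hb)]
    field_simp
  · obtain ⟨hk0, hk1⟩ : 0 < k ∧ k < √(2 * V₀) := hk
    rw [amplitude_zero_left hk0.ne' ha, amplitude_zero_left hk0.ne' hb,
      im_leftResolvent_of_gt a b hk0 hk1, ← stepAlpha_eq hV₀, sqrt_two_mul_sq_div hk0.le,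
      sqrt_two_mul_sq_div (stepAlpha_pos hV₀ hk0 hk1).le, ← Complex.ofReal_mul]
    have hq : stepAlpha V₀ k ^ 2 + k ^ 2 = √(2 * V₀) ^ 2 := by
      rw [stepAlpha_sq hV₀ hk0 hk1, sqrt_two_mul_sq hV₀]; ring
    rw [hq]
    congr 1
    have hN : √(2 / (Real.pi * √(2 * V₀) ^ 2)) ^ 2 = 2 / (Real.pi * √(2 * V₀) ^ 2) :=
      Real.sq_sqrt (by positivity)
    have e : 2 / Real.pi * ((k * cosInt k a + stepAlpha V₀ k * sinInt k a)
        * (k * cosInt k b + stepAlpha V₀ k * sinInt k b) / √(2 * V₀) ^ 2)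
        = 2 / (Real.pi * √(2 * V₀) ^ 2) * ((k * cosInt k a + stepAlpha V₀ k * sinInt k a)
        * (k * cosInt k b + stepAlpha V₀ k * sinInt k b)) := by field_simp
    generalize √(2 / (Real.pi * √(2 * V₀) ^ 2)) = s at hN ⊢
    rw [e, ← hN]
    ring
  · have hk1 : √(2 * V₀) < k := hk
    have hk0 := hv.trans hk1
    have hβ := stepBeta_pos hV₀ hk1
    rw [amplitude_one_left hk0.ne' ha, amplitude_one_left hk0.ne' hb,
      amplitude_two_left hk0.ne' ha, amplitude_two_left hk0.ne' hb,
      im_leftResolvent_of_lt a b hv hk1, ← stepBeta_eq hV₀, sqrt_two_mul_sq_div hβ.le]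
    simp only [stepWeight]
    norm_cast
    have hN : √(2 / (Real.pi * (stepBeta V₀ k ^ 2 + k ^ 2))) ^ 2
      = 2 / (Real.pi * (stepBeta V₀ k ^ 2 + k ^ 2)) := Real.sq_sqrt (by positivity)
    have hM := one_div_sqrt_pi_sq
    calc _ = 2 * k / (stepBeta V₀ k + k) * ((1 / √Real.pi * (1 / √Real.pi))
            * (cosInt k b * cosInt k a))
          + (stepBeta V₀ k ^ 2 + k ^ 2) / (stepBeta V₀ k * (stepBeta V₀ k + k))
            * (√(2 / (Real.pi * (stepBeta V₀ k ^ 2 + k ^ 2))) ^ 2 * (stepBeta V₀ k ^ 2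
            * (sinInt k b * sinInt k a))) := by ring
      _ = _ := by
        rw [hM, hN]
        field_simp
        ring

theorem isIntervalDensity_right : IsIntervalDensity V₀ a b
    fun k => 2 / Real.pi * (rightResolvent √(2 * V₀) a b k).im := by
  have hπ := Real.pi_pos
  have hv := sqrt_two_mul_pos hV₀
  obtain ⟨h1, h2⟩ := integral_im_rightResolvent hv ha hb
  refine ⟨h1.const_mul _, ?_, fun k hk => ?_, fun k hk => ?_⟩
  · rw [integral_const_mul, h2, Set.uIoc_of_le ha, Set.uIoc_of_le hb,
      Set.Ioc_inter_Ioc, Real.volume_real_Ioc, sup_idem, sub_zero, max_eq_left (le_min ha hb)]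
    field_simp
  · obtain ⟨hk0, hk1⟩ : 0 < k ∧ k < √(2 * V₀) := hk
    have hα := stepAlpha_pos hV₀ hk0 hk1
    rw [amplitude_zero_right hα.ne' ha, amplitude_zero_right hα.ne' hb,
      im_rightResolvent_of_gt a b hk0 hk1, ← stepAlpha_eq hV₀, sqrt_two_mul_sq_div hk0.le,
      ← Complex.ofReal_mul]
    have hq : stepAlpha V₀ k ^ 2 + k ^ 2 = √(2 * V₀) ^ 2 := by
      rw [stepAlpha_sq hV₀ hk0 hk1, sqrt_two_mul_sq hV₀]; ring
    rw [hq]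
    congr 1
    have hN : √(2 / (Real.pi * √(2 * V₀) ^ 2)) ^ 2 = 2 / (Real.pi * √(2 * V₀) ^ 2) :=
      Real.sq_sqrt (by positivity)
    have e : 2 / Real.pi * (k ^ 2 / √(2 * V₀) ^ 2
        * (decayInt (stepAlpha V₀ k) a * decayInt (stepAlpha V₀ k) b))
        = 2 / (Real.pi * √(2 * V₀) ^ 2) * (k ^ 2
        * (decayInt (stepAlpha V₀ k) a * decayInt (stepAlpha V₀ k) b)) := by field_simp
    generalize √(2 / (Real.pi * √(2 * V₀) ^ 2)) = s at hN ⊢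
    rw [e, ← hN]
    ring
  · have hk1 : √(2 * V₀) < k := hk
    have hk0 := hv.trans hk1
    have hβ := stepBeta_pos hV₀ hk1
    rw [amplitude_one_right hβ.ne' ha, amplitude_one_right hβ.ne' hb,
      amplitude_two_right hβ.ne' ha, amplitude_two_right hβ.ne' hb,
      im_rightResolvent_of_lt a b hv hk1, ← stepBeta_eq hV₀, sqrt_two_mul_sq_div hk0.le]
    simp only [stepWeight]
    norm_cast
    have hN : √(2 / (Real.pi * (stepBeta V₀ k ^ 2 + k ^ 2))) ^ 2
      = 2 / (Real.pi * (stepBeta V₀ k ^ 2 + k ^ 2)) := Real.sq_sqrt (by positivity)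
    have hM := one_div_sqrt_pi_sq
    calc _ = 2 * k / (stepBeta V₀ k + k) * ((1 / √Real.pi * (1 / √Real.pi))
            * (cosInt (stepBeta V₀ k) b * cosInt (stepBeta V₀ k) a))
          + (stepBeta V₀ k ^ 2 + k ^ 2) / (stepBeta V₀ k * (stepBeta V₀ k + k))
            * (√(2 / (Real.pi * (stepBeta V₀ k ^ 2 + k ^ 2))) ^ 2 * (k ^ 2
            * (sinInt (stepBeta V₀ k) b * sinInt (stepBeta V₀ k) a))) := by ring
      _ = _ := by
        rw [hM, hN]
        field_simp
        ring

theorem isIntervalDensity_cross : IsIntervalDensity V₀ (-a) b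
    fun k => 2 / Real.pi * (crossResolvent √(2 * V₀) a b k).im := by
  have hπ := Real.pi_pos
  have hv := sqrt_two_mul_pos hV₀
  obtain ⟨h1, h2⟩ := integral_im_crossResolvent hv ha hb
  refine ⟨h1.const_mul _, ?_, fun k hk => ?_, fun k hk => ?_⟩
  · rw [integral_const_mul, h2, Set.uIoc_of_ge (neg_nonpos.2 ha), Set.uIoc_of_le hb,
      Set.Ioc_inter_Ioc, Set.Ioc_eq_empty, measureReal_empty, mul_zero]
    simp [hb]
  · obtain ⟨hk0, hk1⟩ : 0 < k ∧ k < √(2 * V₀) := hk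
    have hα := stepAlpha_pos hV₀ hk0 hk1
    rw [amplitude_zero_left hk0.ne' ha, amplitude_zero_right hα.ne' hb,
      im_crossResolvent_of_gt a b hk0 hk1, ← stepAlpha_eq hV₀, sqrt_two_mul_sq_div hk0.le,
      sqrt_two_mul_sq_div (stepAlpha_pos hV₀ hk0 hk1).le, ← Complex.ofReal_mul]
    have hq : stepAlpha V₀ k ^ 2 + k ^ 2 = √(2 * V₀) ^ 2 := by
      rw [stepAlpha_sq hV₀ hk0 hk1, sqrt_two_mul_sq hV₀]; ring
    rw [hq]
    congr 1
    have hN : √(2 / (Real.pi * √(2 * V₀) ^ 2)) ^ 2 = 2 / (Real.pi * √(2 * V₀) ^ 2) :=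
      Real.sq_sqrt (by positivity)
    have e : 2 / Real.pi * (k / √(2 * V₀) ^ 2 * ((k * cosInt k a + stepAlpha V₀ k * sinInt k a)
        * decayInt (stepAlpha V₀ k) b))
        = 2 / (Real.pi * √(2 * V₀) ^ 2) * (k * ((k * cosInt k a + stepAlpha V₀ k * sinInt k a)
        * decayInt (stepAlpha V₀ k) b)) := by field_simp
    generalize √(2 / (Real.pi * √(2 * V₀) ^ 2)) = s at hN ⊢
    rw [e, ← hN]
    ring
  · have hk1 : √(2 * V₀) < k := hk
    have hk0 := hv.trans hk1
    have hβ := stepBeta_pos hV₀ hk1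
    rw [amplitude_one_left hk0.ne' ha, amplitude_one_right hβ.ne' hb,
      amplitude_two_left hk0.ne' ha, amplitude_two_right hβ.ne' hb,
      im_crossResolvent_of_lt a b hv hk1, ← stepBeta_eq hV₀, sqrt_two_mul_sq_div hβ.le,
      sqrt_two_mul_sq_div hk0.le]
    simp only [stepWeight]
    norm_cast
    have hN : √(2 / (Real.pi * (stepBeta V₀ k ^ 2 + k ^ 2))) ^ 2
      = 2 / (Real.pi * (stepBeta V₀ k ^ 2 + k ^ 2)) := Real.sq_sqrt (by positivity)
    have hM := one_div_sqrt_pi_sq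
    calc _ = 2 * k / (stepBeta V₀ k + k) * ((1 / √Real.pi * (1 / √Real.pi))
            * (cosInt (stepBeta V₀ k) b * cosInt k a))
          - (stepBeta V₀ k ^ 2 + k ^ 2) / (stepBeta V₀ k * (stepBeta V₀ k + k))
            * (√(2 / (Real.pi * (stepBeta V₀ k ^ 2 + k ^ 2))) ^ 2 * (stepBeta V₀ k * k
            * (sinInt (stepBeta V₀ k) b * sinInt k a))) := by ring
      _ = _ := by
        rw [hM, hN]
        field_simp
        ring

end Density

theorem exists_isIntervalDensity {V₀ : ℝ} (hV₀ : 0 < V₀) (a b : ℝ) :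
    ∃ J, IsIntervalDensity V₀ a b J := by
  rcases le_total 0 a with ha | ha <;> rcases le_total 0 b with hb | hb
  · exact ⟨_, isIntervalDensity_right hV₀ ha hb⟩
  · have h := isIntervalDensity_cross hV₀ (neg_nonneg.2 hb) ha
    rw [neg_neg] at h
    exact ⟨_, h.symm⟩
  · have h := isIntervalDensity_cross hV₀ (neg_nonneg.2 ha) hb
    rw [neg_neg] at h
    exact ⟨_, h⟩
  · have h := isIntervalDensity_left hV₀ (neg_nonneg.2 ha) (neg_nonneg.2 hb)
    rw [neg_neg, neg_neg] at h
    exact ⟨_, h⟩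

/-! ### The Gram matrix of the amplitudes of intervals -/

theorem exists_stepState_eq_ofReal (V₀ : ℝ) (i : Fin 3) (k : ℝ) :
    ∃ g : ℝ → ℝ, ∀ x, stepState V₀ i k x = g x := by
  fin_cases i
  exacts [⟨evanescentState V₀ k, fun _ => rfl⟩, ⟨cosineState V₀ k, fun _ => rfl⟩,
    ⟨sineState V₀ k, fun _ => rfl⟩]

theorem conj_stepState (V₀ : ℝ) (i : Fin 3) (k x : ℝ) :
    conj (stepState V₀ i k x) = stepState V₀ i k x := by
  obtain ⟨g, hg⟩ := exists_stepState_eq_ofReal V₀ i k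
  rw [hg, Complex.conj_ofReal]

theorem exists_amplitude_uIoc_eq_ofReal (V₀ : ℝ) (i : Fin 3) (b k : ℝ) :
    ∃ r : ℝ, amplitude (stepState V₀ i) ((Ι 0 b).indicator 1) k = r := by
  obtain ⟨g, hg⟩ := exists_stepState_eq_ofReal V₀ i k
  refine ⟨∫ x in Ι 0 b, g x, ?_⟩
  rw [amplitude_indicator_one, ← integral_complex_ofReal, ← integral_conj]
  simp only [hg, Complex.conj_ofReal]

theorem aestronglyMeasurable_amplitude_uIoc (V₀ : ℝ) (i : Fin 3) (b : ℝ) (ν : Measure ℝ)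
    [SFinite ν] :
    AEStronglyMeasurable (amplitude (stepState V₀ i) ((Ι 0 b).indicator 1)) ν :=
  aestronglyMeasurable_amplitude (measurable_stepState i)
    ((integrable_indicator_iff measurableSet_uIoc).2 (integrableOn_const (volume_uIoc_ne_top 0 b)))

theorem stepRange_subset_Ioi {V₀ : ℝ} (i : Fin 3) : stepRange V₀ i ⊆ Set.Ioi 0 := by
  have h : (0:ℝ) ≤ √(2 * V₀) := Real.sqrt_nonneg _
  fin_cases i
  exacts [Set.Ioo_subset_Ioi_self, Set.Ioi_subset_Ioi h, Set.Ioi_subset_Ioi h]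

section Gram

variable {V₀ : ℝ} (hV₀ : 0 < V₀)
include hV₀

/-- On the diagonal the density is a sum of nonnegative terms, so each is dominated by the
integrable `J`. This yields square integrability of the amplitudes. -/
theorem weight_mul_norm_sq_le {b : ℝ} {J : ℝ → ℝ} (hJ : IsIntervalDensity V₀ b b J) (i : Fin 3)
    {k : ℝ} (hk : k ∈ stepRange V₀ i) : stepWeight V₀ i k
      * ‖amplitude (stepState V₀ i) ((Ι 0 b).indicator 1) k‖ ^ 2 ≤ J k := by
  have h0 := hJ.below k
  have h1 := hJ.above k
  have w1 := stepWeight_nonneg hV₀ 1 (k := k)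
  have w2 := stepWeight_nonneg hV₀ 2 (k := k)
  obtain ⟨r0, e0⟩ := exists_amplitude_uIoc_eq_ofReal V₀ 0 b k
  obtain ⟨r1, e1⟩ := exists_amplitude_uIoc_eq_ofReal V₀ 1 b k
  obtain ⟨r2, e2⟩ := exists_amplitude_uIoc_eq_ofReal V₀ 2 b k
  rw [e0] at h0
  rw [e1, e2] at h1
  norm_cast at h0 h1
  fin_cases i
  · change (1:ℝ) * ‖amplitude (stepState V₀ 0) ((Ι 0 b).indicator 1) k‖ ^ 2 ≤ J k
    rw [e0, Complex.norm_real, Real.norm_eq_abs, sq_abs, ← h0 hk]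
    exact le_of_eq (by ring)
  · change stepWeight V₀ 1 k * ‖amplitude (stepState V₀ 1) ((Ι 0 b).indicator 1) k‖ ^ 2 ≤ J k
    rw [e1, Complex.norm_real, Real.norm_eq_abs, sq_abs, ← h1 hk, ← sq, ← sq]
    exact le_add_of_nonneg_right (mul_nonneg (w2 hk) (sq_nonneg _))
  · change stepWeight V₀ 2 k * ‖amplitude (stepState V₀ 2) ((Ι 0 b).indicator 1) k‖ ^ 2 ≤ J k
    rw [e2, Complex.norm_real, Real.norm_eq_abs, sq_abs, ← h1 hk, ← sq, ← sq]
    exact le_add_of_nonneg_left (mul_nonneg (w1 hk) (sq_nonneg _))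

theorem memLp_amplitude_uIoc (i : Fin 3) (b : ℝ) :
    MemLp (amplitude (stepState V₀ i) ((Ι 0 b).indicator 1)) 2 (stepMeasure V₀ i) := by
  have := sigmaFinite_stepMeasure (V₀ := V₀) i
  rw [memLp_two_iff_integrable_sq_norm (aestronglyMeasurable_amplitude_uIoc V₀ i b _),
    integrable_stepMeasure_iff hV₀]
  obtain ⟨J, hJ⟩ := exists_isIntervalDensity hV₀ b b
  refine Integrable.mono' (hJ.integrableOn.mono_set (stepRange_subset_Ioi i)) ?_ ?_
  · exact (measurable_stepWeight i).aestronglyMeasurable.smul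
      ((aestronglyMeasurable_amplitude_uIoc V₀ i b volume).norm.pow 2).restrict
  · filter_upwards [ae_restrict_mem (measurableSet_stepRange i)] with k hk
    rw [smul_eq_mul, Real.norm_eq_abs,
      abs_of_nonneg (mul_nonneg (stepWeight_nonneg hV₀ i hk) (by positivity))]
    exact weight_mul_norm_sq_le hV₀ hJ i hk

theorem integrableOn_weight_mul_amplitude_mul (i : Fin 3) (a b : ℝ) :
    IntegrableOn (fun k => (stepWeight V₀ i k : ℂ)
      * (amplitude (stepState V₀ i) ((Ι 0 b).indicator 1) k
        * amplitude (stepState V₀ i) ((Ι 0 a).indicator 1) k)) (stepRange V₀ i) := by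
  have h := (memLp_amplitude_uIoc hV₀ i b).integrable_mul (memLp_amplitude_uIoc hV₀ i a)
  rw [integrable_stepMeasure_iff hV₀] at h
  exact h

theorem sum_integral_amplitude_mul_conj (a b : ℝ) :
    ∑ i, ∫ k, amplitude (stepState V₀ i) ((Ι 0 b).indicator 1) k
      * conj (amplitude (stepState V₀ i) ((Ι 0 a).indicator 1) k) ∂(stepMeasure V₀ i)
        = (volume.real (Ι 0 a ∩ Ι 0 b) : ℂ) := by
  obtain ⟨J, hJ⟩ := exists_isIntervalDensity hV₀ a b
  have hv := sqrt_two_mul_pos hV₀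
  have hconj : ∀ i k, conj (amplitude (stepState V₀ i) ((Ι 0 a).indicator 1) k)
      = amplitude (stepState V₀ i) ((Ι 0 a).indicator 1) k := fun i k => by
    obtain ⟨r, hr⟩ := exists_amplitude_uIoc_eq_ofReal V₀ i a k
    rw [hr, Complex.conj_ofReal]
  simp only [hconj, integral_stepMeasure hV₀]
  have hi := fun i => integrableOn_weight_mul_amplitude_mul hV₀ i a b
  rw [Fin.sum_univ_three, add_assoc]
  -- The cosine and sine families live on the same range, and only their sum is the density, so
  -- their integrals are merged first.
  have h12 : (∫ k in stepRange V₀ 1, (stepWeight V₀ 1 k : ℂ)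
      * (amplitude (stepState V₀ 1) ((Ι 0 b).indicator 1) k
        * amplitude (stepState V₀ 1) ((Ι 0 a).indicator 1) k))
      + (∫ k in stepRange V₀ 2, (stepWeight V₀ 2 k : ℂ)
      * (amplitude (stepState V₀ 2) ((Ι 0 b).indicator 1) k
        * amplitude (stepState V₀ 2) ((Ι 0 a).indicator 1) k))
      = ((∫ k in Set.Ioi √(2 * V₀), J k : ℝ) : ℂ) := by
    have h2 : stepRange V₀ 2 = stepRange V₀ 1 := rfl
    have hi2 := hi 2
    rw [h2] at hi2 ⊢
    rw [← integral_add (hi 1) hi2, ← integral_complex_ofReal]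
    exact setIntegral_congr_fun measurableSet_Ioi fun k hk => hJ.above k hk
  have h0 : (∫ k in stepRange V₀ 0, (stepWeight V₀ 0 k : ℂ)
      * (amplitude (stepState V₀ 0) ((Ι 0 b).indicator 1) k
        * amplitude (stepState V₀ 0) ((Ι 0 a).indicator 1) k))
      = ((∫ k in Set.Ioc 0 √(2 * V₀), J k : ℝ) : ℂ) := by
    rw [integral_Ioc_eq_integral_Ioo, ← integral_complex_ofReal]
    refine setIntegral_congr_fun measurableSet_Ioo fun k hk => ?_
    simp only [hJ.below k hk, stepWeight, Complex.ofReal_one, one_mul]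
  rw [h12, h0, ← Complex.ofReal_add, ← hJ.integral_eq,
    ← setIntegral_union Set.Ioc_disjoint_Ioi_same measurableSet_Ioi
      (hJ.integrableOn.mono_set Set.Ioc_subset_Ioi_self)
      (hJ.integrableOn.mono_set (Set.Ioi_subset_Ioi hv.le)), Set.Ioc_union_Ioi_eq_Ioi hv.le]

theorem exists_step_resolution_of_identity :
    ∃ U : ∀ i, Lp ℂ 2 (volume : Measure ℝ) →L[ℂ] Lp ℂ 2 (stepMeasure V₀ i),
      (∀ i b, U i (intervalLp b) =ᵐ[stepMeasure V₀ i]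
        amplitude (stepState V₀ i) ((Ι 0 b).indicator 1)) ∧
      ∀ f, ∑ i, (U i).adjoint (U i f) = f :=
  exists_resolution_of_identity (memLp_amplitude_uIoc hV₀) (sum_integral_amplitude_mul_conj hV₀)

theorem isCompleteSystem_stepState : IsCompleteSystem (stepState V₀) (stepMeasure V₀) := by
  have := fun i => sigmaFinite_stepMeasure (V₀ := V₀) i
  obtain ⟨U, hU, hres⟩ := exists_step_resolution_of_identity hV₀
  exact isCompleteSystem_of_resolution measurable_stepState norm_stepState_le
    (stepMeasure_Iic_ne_top hV₀) hU hres

end Gram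

/-! ### Differentiability of the states -/

theorem hasDerivAt_ite_le {f g f' g' : ℝ → ℝ} (hf : ∀ x, HasDerivAt f (f' x) x)
    (hg : ∀ x, HasDerivAt g (g' x) x) (h0 : f 0 = g 0) (h0' : f' 0 = g' 0) (x : ℝ) :
    HasDerivAt (fun x => if x ≤ 0 then f x else g x) (if x ≤ 0 then f' x else g' x) x := by
  rcases lt_trichotomy x 0 with hx | rfl | hx
  · rw [if_pos hx.le]
    refine (hf x).congr_of_eventuallyEq ?_
    filter_upwards [eventually_lt_nhds hx] with y hy
    rw [if_pos hy.le]
  · rw [if_pos le_rfl, ← hasDerivWithinAt_univ, ← Set.Iic_union_Ici (a := (0:ℝ))]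
    refine HasDerivWithinAt.union ?_ ?_
    · exact (hf 0).hasDerivWithinAt.congr (fun y hy => if_pos hy) (if_pos le_rfl)
    · rw [h0']
      refine (hg 0).hasDerivWithinAt.congr (fun y hy => ?_) (by rw [if_pos le_rfl, h0])
      rcases (Set.mem_Ici.1 hy).eq_or_lt with rfl | hy'
      · rw [if_pos le_rfl, h0]
      · exact if_neg (not_le.2 hy')
  · rw [if_neg (not_le.2 hx)]
    refine (hg x).congr_of_eventuallyEq ?_
    filter_upwards [eventually_gt_nhds hx] with y hy
    rw [if_neg (not_le.2 hy)]

/-- Matching value and slope at 0 is what makes the glued function C¹; the second derivative may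
jump there with the potential. -/
theorem isEigenstate_ite {V₀ ε C : ℝ} {f g f' g' f'' g'' : ℝ → ℝ}
    (hf : ∀ x, HasDerivAt f (f' x) x) (hg : ∀ x, HasDerivAt g (g' x) x)
    (hf' : ∀ x, HasDerivAt f' (f'' x) x) (hg' : ∀ x, HasDerivAt g' (g'' x) x)
    (h0 : f 0 = g 0) (h0' : f' 0 = g' 0)
    (hfe : ∀ x, f'' x = -(2 * ε) * f x) (hge : ∀ x, g'' x = (2 * V₀ - 2 * ε) * g x)
    {φ : ℝ → ℂ} (hφ : ∀ x, φ x = ((if x ≤ 0 then f x else g x : ℝ) : ℂ))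
    (hne : φ ≠ 0) (hC : ∀ x, ‖φ x‖ ≤ C) : IsEigenstate (stepPotential V₀) ε φ := by
  obtain rfl : φ = fun x => ((if x ≤ 0 then f x else g x : ℝ) : ℂ) := funext hφ
  have hd := fun x => (hasDerivAt_ite_le hf hg h0 h0' x).ofReal_comp
  have hderiv : deriv (fun x : ℝ => ((if x ≤ 0 then f x else g x : ℝ) : ℂ))
      = fun x => ((if x ≤ 0 then f' x else g' x : ℝ) : ℂ) := funext fun x => (hd x).deriv
  have hcf : Continuous f' := continuous_iff_continuousAt.2 fun x => (hf' x).continuousAt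
  have hcg : Continuous g' := continuous_iff_continuousAt.2 fun x => (hg' x).continuousAt
  refine ⟨hne, ⟨C, hC⟩, contDiff_one_iff_deriv.2 ⟨fun x => (hd x).differentiableAt, ?_⟩, ?_⟩
  · rw [hderiv]
    exact Complex.continuous_ofReal.comp (hcf.if_le hcg continuous_id continuous_const
      fun x hx => by rw [show x = 0 from hx, h0'])
  · intro x hx
    rw [hderiv]
    rcases hx.lt_or_gt with hx | hx
    · have h2 : HasDerivAt (fun x : ℝ => ((if x ≤ 0 then f' x else g' x : ℝ) : ℂ))
          (f'' x : ℂ) x := by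
        refine (hf' x).ofReal_comp.congr_of_eventuallyEq ?_
        filter_upwards [eventually_lt_nhds hx] with y hy
        rw [if_pos hy.le]
      refine ⟨h2.differentiableAt, ?_⟩
      rw [h2.deriv, hfe, stepPotential, if_pos hx]
      simp only [if_pos hx.le]
      push_cast; ring
    · have h2 : HasDerivAt (fun x : ℝ => ((if x ≤ 0 then f' x else g' x : ℝ) : ℂ))
          (g'' x : ℂ) x := by
        refine (hg' x).ofReal_comp.congr_of_eventuallyEq ?_
        filter_upwards [eventually_gt_nhds hx] with y hy
        rw [if_neg (not_le.2 hy)]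
      refine ⟨h2.differentiableAt, ?_⟩
      rw [h2.deriv, hge, stepPotential, if_neg (not_lt.2 hx.le)]
      simp only [if_neg (not_le.2 hx)]
      push_cast; ring

theorem hasDerivAt_const_mul_cos (c k x : ℝ) :
    HasDerivAt (fun x => c * Real.cos (k * x)) (-(c * k) * Real.sin (k * x)) x := by
  have h := (((hasDerivAt_id x).const_mul k).cos).const_mul c
  refine h.congr_deriv ?_
  simp only [id, mul_one]; ring

theorem hasDerivAt_const_mul_sin (c k x : ℝ) :
    HasDerivAt (fun x => c * Real.sin (k * x)) (c * k * Real.cos (k * x)) x := by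
  have h := (((hasDerivAt_id x).const_mul k).sin).const_mul c
  refine h.congr_deriv ?_
  simp only [id, mul_one]; ring

theorem hasDerivAt_const_mul_exp_neg (c α x : ℝ) :
    HasDerivAt (fun x => c * Real.exp (-(α * x))) (-(c * α) * Real.exp (-(α * x))) x := by
  have h := (((hasDerivAt_id x).const_mul α).neg.exp).const_mul c
  refine h.congr_deriv ?_
  simp only [id, mul_one, Pi.neg_apply]; ring

section Eigenstates

variable {V₀ : ℝ} (hV₀ : 0 < V₀) {k : ℝ}
include hV₀

theorem isEigenstate_evanescent (hk0 : 0 < k) (hk : k < √(2 * V₀)) :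
    IsEigenstate (stepPotential V₀) (k ^ 2 / 2) (stepState V₀ 0 k) := by
  have hα := stepAlpha_pos hV₀ hk0 hk
  have hα2 := stepAlpha_sq hV₀ hk0 hk
  have hM := sqrt_two_mul_sq_div (q := stepAlpha V₀ k ^ 2 + k ^ 2) hα.le
  have hN := sqrt_two_mul_sq_div (q := stepAlpha V₀ k ^ 2 + k ^ 2) hk0.le
  have hNpos : 0 < √(2 * k ^ 2 / (Real.pi * (stepAlpha V₀ k ^ 2 + k ^ 2))) :=
    Real.sqrt_pos.2 (by have := Real.pi_pos; positivity)
  have hφ : ∀ x, stepState V₀ 0 k x = ((evanescentState V₀ k x : ℝ) : ℂ) := fun x => rfl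
  simp only [evanescentState] at hφ
  set N := √(2 * k ^ 2 / (Real.pi * (stepAlpha V₀ k ^ 2 + k ^ 2)))
  set M := √(2 * stepAlpha V₀ k ^ 2 / (Real.pi * (stepAlpha V₀ k ^ 2 + k ^ 2)))
  -- Equality of the slopes at 0, which are -Mk from the left and -Nα from the right.
  have hMN : M * k = N * stepAlpha V₀ k := by rw [hM, hN]; ring
  refine isEigenstate_ite (f := fun x => N * Real.cos (k * x) - M * Real.sin (k * x))
    (f' := fun x => -(N * k) * Real.sin (k * x) - M * k * Real.cos (k * x))
    (g' := fun x => -(N * stepAlpha V₀ k) * Real.exp (-(stepAlpha V₀ k * x)))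
    (f'' := fun x => -(N * k) * k * Real.cos (k * x) - -(M * k * k) * Real.sin (k * x))
    (g'' := fun x => -(-(N * stepAlpha V₀ k) * stepAlpha V₀ k)
      * Real.exp (-(stepAlpha V₀ k * x)))
    (fun x => (hasDerivAt_const_mul_cos _ _ _).sub (hasDerivAt_const_mul_sin _ _ _))
    (fun x => hasDerivAt_const_mul_exp_neg _ _ _)
    (fun x => (hasDerivAt_const_mul_sin _ _ _).sub (hasDerivAt_const_mul_cos _ _ _))
    (fun x => hasDerivAt_const_mul_exp_neg _ _ _) (by simp) (by simp [hMN])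
    (fun x => by ring) (fun x => ?_) hφ ?_ (norm_stepState_le 0 k)
  · linear_combination N * Real.exp (-(stepAlpha V₀ k * x)) * hα2
  · intro h
    have := congrFun h 0
    rw [hφ] at this
    simp [hNpos.ne'] at this

theorem isEigenstate_cosine (hk : √(2 * V₀) < k) :
    IsEigenstate (stepPotential V₀) (k ^ 2 / 2) (stepState V₀ 1 k) := by
  have hβ2 := stepBeta_sq hV₀ hk
  have hφ : ∀ x, stepState V₀ 1 k x = ((cosineState V₀ k x : ℝ) : ℂ) := fun x => rfl
  simp only [cosineState] at hφ
  have hN : 0 < 1 / √Real.pi := by have := Real.pi_pos; positivity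
  set N := 1 / √Real.pi
  refine isEigenstate_ite
    (f' := fun x => -(N * k) * Real.sin (k * x))
    (g' := fun x => -(N * stepBeta V₀ k) * Real.sin (stepBeta V₀ k * x))
    (f'' := fun x => -(N * k) * k * Real.cos (k * x))
    (g'' := fun x => -(N * stepBeta V₀ k) * stepBeta V₀ k * Real.cos (stepBeta V₀ k * x))
    (fun x => hasDerivAt_const_mul_cos _ _ _) (fun x => hasDerivAt_const_mul_cos _ _ _)
    (fun x => hasDerivAt_const_mul_sin _ _ _) (fun x => hasDerivAt_const_mul_sin _ _ _)
    (by simp) (by simp) (fun x => by ring) (fun x => ?_) hφ ?_ (norm_stepState_le 1 k)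
  · linear_combination -(N * Real.cos (stepBeta V₀ k * x)) * hβ2
  · intro h
    have := congrFun h 0
    rw [hφ] at this
    simp [hN.ne'] at this

theorem isEigenstate_sine (hk : √(2 * V₀) < k) :
    IsEigenstate (stepPotential V₀) (k ^ 2 / 2) (stepState V₀ 2 k) := by
  have hk0 := (sqrt_two_mul_pos hV₀).trans hk
  have hβ := stepBeta_pos hV₀ hk
  have hβ2 := stepBeta_sq hV₀ hk
  have hM := sqrt_two_mul_sq_div (q := stepBeta V₀ k ^ 2 + k ^ 2) hβ.le
  have hN := sqrt_two_mul_sq_div (q := stepBeta V₀ k ^ 2 + k ^ 2) hk0.le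
  have hMpos : 0 < √(2 * stepBeta V₀ k ^ 2 / (Real.pi * (stepBeta V₀ k ^ 2 + k ^ 2))) :=
    Real.sqrt_pos.2 (by have := Real.pi_pos; positivity)
  have hφ : ∀ x, stepState V₀ 2 k x = ((sineState V₀ k x : ℝ) : ℂ) := fun x => rfl
  simp only [sineState] at hφ
  set N := √(2 * k ^ 2 / (Real.pi * (stepBeta V₀ k ^ 2 + k ^ 2)))
  set M := √(2 * stepBeta V₀ k ^ 2 / (Real.pi * (stepBeta V₀ k ^ 2 + k ^ 2)))
  have hMN : M * k = N * stepBeta V₀ k := by rw [hM, hN]; ring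
  refine isEigenstate_ite
    (f' := fun x => M * k * Real.cos (k * x))
    (g' := fun x => N * stepBeta V₀ k * Real.cos (stepBeta V₀ k * x))
    (f'' := fun x => -(M * k * k) * Real.sin (k * x))
    (g'' := fun x => -(N * stepBeta V₀ k * stepBeta V₀ k) * Real.sin (stepBeta V₀ k * x))
    (fun x => hasDerivAt_const_mul_sin _ _ _) (fun x => hasDerivAt_const_mul_sin _ _ _)
    (fun x => hasDerivAt_const_mul_cos _ _ _) (fun x => hasDerivAt_const_mul_cos _ _ _)
    (by simp) (by simp [hMN]) (fun x => by ring) (fun x => ?_) hφ ?_ (norm_stepState_le 2 k)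
  · linear_combination -(N * Real.sin (stepBeta V₀ k * x)) * hβ2
  · intro h
    -- The sine state vanishes at 0, so it is tested where kx = -π/2.
    have h1 := congrFun h (-(Real.pi / 2 / k))
    rw [hφ, if_pos (neg_nonpos.2 (by have := Real.pi_pos; positivity))] at h1
    have h2 : k * -(Real.pi / 2 / k) = -(Real.pi / 2) := by field_simp
    rw [h2, Real.sin_neg, Real.sin_pi_div_two] at h1
    simp [hMpos.ne'] at h1

theorem isEigenstate_stepState (i : Fin 3) (hk : k ∈ stepRange V₀ i) :
    IsEigenstate (stepPotential V₀) (k ^ 2 / 2) (stepState V₀ i k) := by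
  fin_cases i
  exacts [isEigenstate_evanescent hV₀ hk.1 hk.2, isEigenstate_cosine hV₀ hk,
    isEigenstate_sine hV₀ hk]

end Eigenstates

/-! ### Decay of the amplitudes of box states -/

/-- Green's identity: off 0, (φ'f - φf')' = 2Vφf - (2ε - μ²)φf for the box sine f. Since f vanishes
at both walls, the boundary terms contain no φ', for which no bound uniform in the energy is
available. Keeping V as a bounded term treats boxes on one side of 0 and across it alike. -/
theorem norm_integral_mul_sin_le_of_isEigenstate {V₀ ε C A μ τ σ : ℝ} (hV₀ : 0 ≤ V₀) {φ : ℝ → ℂ}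
    (h : IsEigenstate (stepPotential V₀) ε φ) (hC : ∀ x, ‖φ x‖ ≤ C) (hσ : 0 ≤ σ)
    (hsin : Real.sin (μ * σ) = 0) :
    |2 * ε - μ ^ 2| * ‖∫ x in τ..τ + σ, φ x * ((A * Real.sin (μ * (x - τ)) : ℝ) : ℂ)‖
      ≤ 2 * (C * (|A| * |μ|)) + 2 * V₀ * (C * |A|) * σ := by
  obtain ⟨-, -, hφ1, hφ2⟩ := h
  have hC0 : 0 ≤ C := (norm_nonneg _).trans (hC 0)
  have hle : τ ≤ τ + σ := le_add_of_nonneg_right hσ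
  set f : ℝ → ℝ := fun x => A * Real.sin (μ * (x - τ)) with hf
  set f' : ℝ → ℝ := fun x => A * μ * Real.cos (μ * (x - τ)) with hf'
  have hdf : ∀ x, HasDerivAt f (f' x) x := fun x => by
    have := ((((hasDerivAt_id x).sub_const τ).const_mul μ).sin).const_mul A
    refine this.congr_deriv ?_
    simp only [hf', id, mul_one]; ring
  have hdf' : ∀ x, HasDerivAt f' (-μ ^ 2 * f x) x := fun x => by
    have := ((((hasDerivAt_id x).sub_const τ).const_mul μ).cos).const_mul (A * μ)
    refine this.congr_deriv ?_
    simp only [hf, id, mul_one]; ring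
  have hfc : Continuous f := by fun_prop
  have hfc' : Continuous f' := by fun_prop
  have hfb : ∀ x, |f x| ≤ |A| := fun x => by
    rw [hf, abs_mul]
    exact mul_le_of_le_one_right (abs_nonneg _) (Real.abs_sin_le_one _)
  have hfb' : ∀ x, |f' x| ≤ |A| * |μ| := fun x => by
    rw [hf', abs_mul, abs_mul]
    exact mul_le_of_le_one_right (by positivity) (Real.abs_cos_le_one _)
  have hφc : Continuous φ := hφ1.continuous
  have hφd : Continuous (deriv φ) := hφ1.continuous_deriv (le_refl 1)
  have hVb : ∀ x, |stepPotential V₀ x| ≤ V₀ := fun x => by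
    rw [stepPotential]; split_ifs
    · simpa using hV₀
    · rw [abs_of_nonneg hV₀]
  have hVm : Measurable (stepPotential V₀) :=
    Measurable.ite measurableSet_Iio measurable_const measurable_const
  have hi1 : IntervalIntegrable (fun x => φ x * (f x : ℂ)) volume τ (τ + σ) :=
    Continuous.intervalIntegrable (by fun_prop) _ _
  have hVbd : ∀ x, ‖(stepPotential V₀ x : ℂ) * (φ x * (f x : ℂ))‖ ≤ V₀ * (C * |A|) := fun x => by
    rw [norm_mul, norm_mul, Complex.norm_real, Complex.norm_real]
    exact mul_le_mul (hVb x) (mul_le_mul (hC x) (hfb x) (abs_nonneg _) hC0) (by positivity) hV₀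
  have hi2 : IntervalIntegrable (fun x => (stepPotential V₀ x : ℂ) * (φ x * (f x : ℂ))) volume τ
      (τ + σ) := by
    rw [intervalIntegrable_iff_integrableOn_Ioc_of_le hle]
    refine Integrable.of_bound ?_ (V₀ * (C * |A|)) (Eventually.of_forall hVbd)
    exact ((Complex.measurable_ofReal.comp hVm).aestronglyMeasurable).mul
      (by fun_prop : Continuous fun x => φ x * (f x : ℂ)).aestronglyMeasurable
  -- The point 0, where φ'' may fail to exist, is a countable exception; continuity of φ' suffices
  -- there.
  have hFTC := integral_eq_of_hasDerivAt_off_countable_of_le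
    (fun x => deriv φ x * (f x : ℂ) - φ x * (f' x : ℂ))
    (fun x => 2 * ((stepPotential V₀ x : ℂ) * (φ x * (f x : ℂ)))
      - ((2 * ε - μ ^ 2 : ℝ) : ℂ) * (φ x * (f x : ℂ))) hle (Set.countable_singleton (0:ℝ))
    (by fun_prop) (by
      intro x hx
      obtain ⟨hd, he⟩ := hφ2 x hx.2
      have h1 := (hd.hasDerivAt.mul (hdf x).ofReal_comp).sub
        ((hφ1.differentiable (by norm_num) x).hasDerivAt.mul (hdf' x).ofReal_comp)
      refine h1.congr_deriv ?_
      push_cast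
      linear_combination (-2 * (f x : ℂ)) * he)
    ((hi2.const_mul 2).sub (hi1.const_mul _))
  rw [intervalIntegral.integral_sub (hi2.const_mul 2) (hi1.const_mul _),
    intervalIntegral.integral_const_mul, intervalIntegral.integral_const_mul] at hFTC
  have hf0 : f τ = 0 := by simp [hf]
  have hf1 : f (τ + σ) = 0 := by simp [hf, hsin]
  rw [hf0, hf1] at hFTC
  have heq : ((2 * ε - μ ^ 2 : ℝ) : ℂ) * (∫ x in τ..τ + σ, φ x * (f x : ℂ))
      = φ (τ + σ) * f' (τ + σ) - φ τ * f' τ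
        + 2 * ∫ x in τ..τ + σ, (stepPotential V₀ x : ℂ) * (φ x * (f x : ℂ)) := by
    simp only [Complex.ofReal_zero, mul_zero, zero_sub] at hFTC
    linear_combination -hFTC
  have hb : ∀ x, ‖φ x * (f' x : ℂ)‖ ≤ C * (|A| * |μ|) := fun x => by
    rw [norm_mul, Complex.norm_real]
    exact mul_le_mul (hC x) (hfb' x) (abs_nonneg _) hC0
  have hI : ‖∫ x in τ..τ + σ, (stepPotential V₀ x : ℂ) * (φ x * (f x : ℂ))‖
      ≤ V₀ * (C * |A|) * σ := by
    have := intervalIntegral.norm_integral_le_of_norm_le_const (a := τ) (b := τ + σ)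
      fun x _ => hVbd x
    rwa [add_sub_cancel_left, abs_of_nonneg hσ] at this
  rw [← Real.norm_eq_abs, ← Complex.norm_real, ← norm_mul, heq]
  refine (norm_add_le _ _).trans ((add_le_add ((norm_sub_le _ _).trans
    (add_le_add (hb _) (hb _))) (le_of_eq (norm_mul _ _))).trans ?_)
  rw [Complex.norm_ofNat]
  linarith

theorem boxState_eq_indicator (j : ℕ) (τ σ : ℝ) :
    boxState j τ σ = (Set.Ioo τ (τ + σ)).indicator fun x =>
      ((√(2 / σ) * Real.sin (j * Real.pi / σ * (x - τ)) : ℝ) : ℂ) := by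
  funext x
  rw [boxState, Set.indicator_apply]
  rfl

theorem continuous_boxState (j : ℕ) (τ : ℝ) {σ : ℝ} (hσ : 0 < σ) :
    Continuous (boxState j τ σ) := by
  -- The sine vanishes at both walls, so clamping `x` to the box reproduces the extension by zero.
  have h : boxState j τ σ = fun x => ((√(2 / σ) * Real.sin (j * Real.pi / σ
      * (max τ (min x (τ + σ)) - τ)) : ℝ) : ℂ) := by
    funext x
    rw [boxState]
    split_ifs with hx
    · rw [min_eq_left hx.2.le, max_eq_right hx.1.le]
    · rcases le_or_gt x τ with h1 | h1
      · rw [max_eq_left ((min_le_left _ _).trans h1)]; simp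
      · have h2 : τ + σ ≤ x := not_lt.1 fun h2 => hx ⟨h1, h2⟩
        rw [min_eq_right h2, max_eq_right (by linarith), add_sub_cancel_left,
          div_mul_cancel₀ _ hσ.ne', Real.sin_nat_mul_pi]
        simp
  rw [h]
  fun_prop

theorem integrable_boxState (j : ℕ) (τ σ : ℝ) : Integrable (boxState j τ σ) := by
  rw [boxState_eq_indicator, integrable_indicator_iff measurableSet_Ioo]
  exact ((Continuous.continuousOn (by fun_prop)).integrableOn_Icc (a := τ) (b := τ + σ)).mono_set
    Set.Ioo_subset_Icc_self

theorem memLp_boxState (j : ℕ) (τ σ : ℝ) : MemLp (boxState j τ σ) 2 volume := by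
  rw [boxState_eq_indicator, memLp_indicator_iff_restrict measurableSet_Ioo]
  refine MemLp.of_bound (Continuous.aestronglyMeasurable (by fun_prop)) √(2 / σ)
    (Eventually.of_forall fun x => ?_)
  rw [Complex.norm_real, Real.norm_eq_abs, abs_mul, abs_of_nonneg (Real.sqrt_nonneg _)]
  exact mul_le_of_le_one_right (Real.sqrt_nonneg _) (Real.abs_sin_le_one _)

theorem amplitude_boxState (V₀ : ℝ) (i : Fin 3) (j : ℕ) (τ : ℝ) {σ : ℝ} (hσ : 0 < σ) (k : ℝ) :
    amplitude (stepState V₀ i) (boxState j τ σ) k = ∫ x in τ..τ + σ, stepState V₀ i k x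
      * ((√(2 / σ) * Real.sin (j * Real.pi / σ * (x - τ)) : ℝ) : ℂ) := by
  rw [amplitude, intervalIntegral.integral_of_le (by linarith), integral_Ioc_eq_integral_Ioo,
    ← integral_indicator measurableSet_Ioo, boxState_eq_indicator]
  congr 1 with x
  rw [conj_stepState]
  by_cases hx : x ∈ Set.Ioo τ (τ + σ) <;> simp [hx]

/-! ### Absolute convergence and pointwise recovery of the box states. -/

section Box

variable {V₀ : ℝ} (hV₀ : 0 < V₀)
include hV₀

theorem stepWeight_le_four (i : Fin 3) {k : ℝ} (hk : k ∈ stepRange V₀ i)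
    (hk2 : 2 * √(2 * V₀) ≤ k) : stepWeight V₀ i k ≤ 4 := by
  have hv := sqrt_two_mul_pos hV₀
  have hk0 : 0 < k := by linarith
  have hk1 : √(2 * V₀) < k := by linarith
  have hβ := stepBeta_pos hV₀ hk1
  have hβ2 := stepBeta_sq hV₀ hk1
  rw [← sqrt_two_mul_sq hV₀] at hβ2
  have hkβ : k ≤ 2 * stepBeta V₀ k := by
    by_contra! hlt
    nlinarith
  have hβk : stepBeta V₀ k ≤ k := by
    by_contra! hlt
    nlinarith
  fin_cases i
  · change (1:ℝ) ≤ 4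
    norm_num
  · change 2 * k / (stepBeta V₀ k + k) ≤ 4
    rw [div_le_iff₀ (by positivity)]
    linarith
  · change (stepBeta V₀ k ^ 2 + k ^ 2) / (stepBeta V₀ k * (stepBeta V₀ k + k)) ≤ 4
    rw [div_le_iff₀ (by positivity)]
    nlinarith

theorem exists_norm_amplitude_boxState_le (i : Fin 3) (j : ℕ) (τ : ℝ) {σ : ℝ} (hσ : 0 < σ) :
    ∃ B K : ℝ, 0 < K ∧ ∀ k ∈ stepRange V₀ i, K ≤ k →
      ‖amplitude (stepState V₀ i) (boxState j τ σ) k‖ ≤ B * k ^ (-2 : ℝ) := by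
  set μ := j * Real.pi / σ with hμ
  set D := 2 * (2 * (|√(2 / σ)| * |μ|)) + 2 * V₀ * (2 * |√(2 / σ)|) * σ with hD
  -- `D` is the bound from Green's identity with C = 2. For k ≥ 2|μ| one has |k² - μ²| ≥ k²/2, and
  -- dividing by k²/2 produces 2D.
  refine ⟨2 * D, 2 * |μ| + 1, by positivity, fun k hk hKk => ?_⟩
  have hsin : Real.sin (μ * σ) = 0 := by
    rw [hμ, div_mul_cancel₀ _ hσ.ne', Real.sin_nat_mul_pi]
  have h := norm_integral_mul_sin_le_of_isEigenstate (A := √(2 / σ)) (μ := μ) (τ := τ) hV₀.le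
    (isEigenstate_stepState hV₀ i hk) (norm_stepState_le i k) hσ.le hsin
  rw [← amplitude_boxState V₀ i j τ hσ k] at h
  have hk0 : 0 < k := stepRange_subset_Ioi i hk
  have hm := abs_nonneg μ
  have h1 : k ^ 2 / 2 ≤ |2 * (k ^ 2 / 2) - μ ^ 2| := by
    refine le_trans ?_ (le_abs_self _)
    rw [← sq_abs μ]
    nlinarith
  have h2 := (mul_le_mul_of_nonneg_right h1 (norm_nonneg _)).trans h
  rw [Real.rpow_neg hk0.le, Real.rpow_two, ← div_eq_mul_inv, le_div_iff₀ (by positivity)]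
  linarith

/-- Up to `K` the amplitude is bounded and the measure finite, despite the threshold singularity.
Beyond `K` the weight is at most 4 and the amplitude is O(k⁻²). -/
theorem integrable_amplitude_boxState (i : Fin 3) (j : ℕ) (τ : ℝ) {σ : ℝ} (hσ : 0 < σ) :
    Integrable (amplitude (stepState V₀ i) (boxState j τ σ)) (stepMeasure V₀ i) := by
  obtain ⟨B, K', hK', hB⟩ := exists_norm_amplitude_boxState_le hV₀ i j τ hσ
  have hv := sqrt_two_mul_pos hV₀
  set K := max K' (2 * √(2 * V₀)) with hKdef
  have hK : 0 < K := hK'.trans_le (le_max_left _ _)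
  have hmeas : AEStronglyMeasurable (fun k => stepWeight V₀ i k
      • amplitude (stepState V₀ i) (boxState j τ σ) k) volume :=
    (measurable_stepWeight i).aestronglyMeasurable.smul
      (aestronglyMeasurable_amplitude (measurable_stepState i) (integrable_boxState j τ σ))
  rw [integrable_stepMeasure_iff hV₀, ← Set.inter_union_compl (stepRange V₀ i) (Set.Iic K)]
  refine IntegrableOn.union ?_ ?_
  · refine Integrable.mono' ((integrableOn_stepWeight hV₀ i K).mul_const
      (2 * ∫ x, ‖boxState j τ σ x‖)) hmeas.restrict ?_
    filter_upwards [ae_restrict_mem ((measurableSet_stepRange i).inter measurableSet_Iic)] with k hk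
    rw [norm_smul, Real.norm_eq_abs, abs_of_nonneg (stepWeight_nonneg hV₀ i hk.1)]
    exact mul_le_mul_of_nonneg_left (norm_amplitude_le (norm_stepState_le i)
      (integrable_boxState j τ σ) k) (stepWeight_nonneg hV₀ i hk.1)
  · rw [Set.compl_Iic]
    have hg : IntegrableOn (fun k : ℝ => 4 * (B * k ^ (-2 : ℝ)))
        (stepRange V₀ i ∩ Set.Ioi K) :=
      IntegrableOn.mono_set (t := Set.Ioi K)
        (((integrableOn_Ioi_rpow_of_lt (by norm_num) hK).const_mul B).const_mul 4)
        Set.inter_subset_right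
    refine Integrable.mono' hg hmeas.restrict ?_
    filter_upwards [ae_restrict_mem ((measurableSet_stepRange i).inter measurableSet_Ioi)] with k hk
    have hKk : K < k := hk.2
    rw [norm_smul, Real.norm_eq_abs, abs_of_nonneg (stepWeight_nonneg hV₀ i hk.1)]
    exact mul_le_mul (stepWeight_le_four hV₀ i hk.1 ((le_max_right _ _).trans hKk.le))
      (hB k hk.1 ((le_max_left _ _).trans hKk.le)) (norm_nonneg _) (by norm_num)

theorem continuous_superposition_boxState (i : Fin 3) (j : ℕ) (τ : ℝ) {σ : ℝ} (hσ : 0 < σ) :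
    Continuous fun x => ∫ k, amplitude (stepState V₀ i) (boxState j τ σ) k * stepState V₀ i k x
      ∂(stepMeasure V₀ i) := by
  have hi := integrable_amplitude_boxState hV₀ i j τ hσ
  refine continuous_of_dominated
    (bound := fun k => ‖amplitude (stepState V₀ i) (boxState j τ σ) k‖ * 2)
    (fun x => (integrable_superposition (measurable_stepState i) (norm_stepState_le i) hi x).1)
    (fun x => Eventually.of_forall fun k => ?_) (hi.norm.mul_const 2) ?_
  · rw [norm_mul]
    exact mul_le_mul_of_nonneg_left (norm_stepState_le i k x) (norm_nonneg _)
  · filter_upwards [ae_stepMeasure_mem i] with k hk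
    exact continuous_const.mul (isEigenstate_stepState hV₀ i hk).2.2.1.continuous

/-- Two continuous functions equal almost everywhere are equal everywhere, in particular at the
walls and at the step. -/
theorem sum_superposition_boxState (j : ℕ) (τ : ℝ) {σ : ℝ} (hσ : 0 < σ) (x : ℝ) :
    ∑ i, ∫ k, amplitude (stepState V₀ i) (boxState j τ σ) k * stepState V₀ i k x
      ∂(stepMeasure V₀ i) = boxState j τ σ x := by
  have := fun i => sigmaFinite_stepMeasure (V₀ := V₀) i
  obtain ⟨U, hU, hres⟩ := exists_step_resolution_of_identity hV₀
  have hae := ae_eq_sum_superposition_amplitude measurable_stepState norm_stepState_le hU hres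
    (integrable_boxState j τ σ) (memLp_boxState j τ σ)
    fun i => integrable_amplitude_boxState hV₀ i j τ hσ
  have hc : Continuous fun x => ∑ i, ∫ k, amplitude (stepState V₀ i) (boxState j τ σ) k
      * stepState V₀ i k x ∂(stepMeasure V₀ i) :=
    continuous_finsetSum _ fun i _ => continuous_superposition_boxState hV₀ i j τ hσ
  exact congrFun ((hc.ae_eq_iff_eq volume (continuous_boxState j τ hσ)).1 hae) x

end Box

end StepCompleteness

theorem mainTheorem2 (V₀ : ℝ) (hV₀ : 0 < V₀) :
    (∀ (i : Fin 3), ∀ k ∈ stepRange V₀ i,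
      DifferentiableAt ℝ (stepSpectral V₀ i) k ∧
      IsEigenstate (stepPotential V₀) (k ^ 2 / 2) (stepState V₀ i k)) ∧
    IsCompleteSystem (stepState V₀) (stepMeasure V₀) ∧
    (∀ (j : ℕ) (τ σ : ℝ), 1 ≤ j → 0 < σ → ∀ x : ℝ,
      (∀ i : Fin 3, Integrable
        (fun k => amplitude (stepState V₀ i) (boxState j τ σ) k * stepState V₀ i k x)
        (stepMeasure V₀ i)) ∧
      ∑ i : Fin 3, ∫ k, amplitude (stepState V₀ i) (boxState j τ σ) k * stepState V₀ i k x
        ∂(stepMeasure V₀ i) = boxState j τ σ x) := by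
  refine ⟨fun i k hk => ⟨?_, isEigenstate_stepState hV₀ i hk⟩, isCompleteSystem_stepState hV₀,
    fun j τ σ _ hσ x => ⟨fun i => ?_, sum_superposition_boxState hV₀ j τ hσ x⟩⟩
  · obtain ⟨d, hd, -⟩ := hasDerivAt_stepSpectral hV₀ i hk
    exact hd.differentiableAt
  · exact integrable_superposition (measurable_stepState i) (norm_stepState_le i)
      (integrable_amplitude_boxState hV₀ i j τ hσ) x
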